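/- Let $G=(V,E)$ be a connected finite simple graph with $n$ vertices and clique number $\omega(G)$. For distinct $x,y\in V$ let $I(x,y)$ be the set of vertices lying on some induced path between $x$ and $y$, and let $I(x,x)=\emptyset$. A set $X\subseteq V$ is m-convex if $I(x,y)\subseteq X$ for all $x,y\in X$; an m-halfspace is a set $H\subseteq V$ such that $H$ and $V\setminus H$ are m-convex. The shadow of $z$ with respect to $w$ is $z/w=\{x\in V : z\in I(x,w)\}$. For an edge $\{u,v\}$ let $\triangle_{uv}=(N(u)\cap N(v))\cup\{u,v\}$, and let $\neg G[\triangle_{uv}]$ be the complement of the subgraph induced by $\triangle_{uv}$. Algorithm mh-fpt-list: print $\emptyset$ and $V$, and let $B=\emptyset$. For each edge $\{u,v\}\in E$ such that $\neg G[\triangle_{uv}]$ is bipartite, choose a set $R$ with exactly one vertex $x_C$ from each connected component $C$ of $\neg G[\triangle_{uv}]$. For each $U\subseteq R$, let $S$ be the union, over all components $C$, of the side of the bipartition of $C$ that contains $x_C$ if $x_C\in U$, and of the other side if $x_C\notin U$. If exactly one of $u,v$ is in $S$, let $w$ be the one that is not in $S$, and let $X=\bigcup_{z\in S} z/w$; print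 $X$ if $X$ and $V\setminus X$ are m-convex and no edge of $B$ joins $X$ to $V\setminus X$. After all $U\subseteq R$ have been treated, add $\{u,v\}$ to $B$. Theorem. The algorithm mh-fpt-list, implemented as a program on a machine with vertex registers, Boolean arrays indexed by vertices and by pairs of vertices, and unit cost for elementary operations, lists all m-halfspaces of $G$ (including $\emptyset$ and $V$), each exactly once, and nothing else, in at most $2^{\omega(G)}P(n)$ steps, where $P$ is a polynomial that does not depend on $G$. Moreover, whenever $H$ is an m-halfspace and $\{u,v\}\in E$ with $u\in H$, $v\notin H$, the graph $\neg G[\triangle_{uv}]$ is bipartite, each of its edges joins $H$ to $V\setminus H$, and $H=\bigcup_{z\in \triangle_{uv}\cap H} z/v$. -/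

import Mathlib

/-! ## Monophonic convexity -/

section Monophonic

variable {V : Type*}

/-- The monophonic interval `I(u,v)`: all vertices on some induced path between the distinct
vertices `u` and `v`; by convention `I(u,u) = ∅`. -/
def mInterval (G : SimpleGraph V) (u v : V) : Set V :=
  {z | u ≠ v ∧ ∃ p : G.Walk u v, p.IsPath ∧ p.IsChordless ∧ z ∈ p.support}

/-- Monophonically convex sets. -/
def IsMConvex (G : SimpleGraph V) (X : Set V) : Prop :=
  ∀ u ∈ X, ∀ v ∈ X, mInterval G u v ⊆ X

/-- Monophonic halfspaces: the set and its complement are both m-convex. -/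
def IsMHalfspace (G : SimpleGraph V) (X : Set V) : Prop :=
  IsMConvex G X ∧ IsMConvex G Xᶜ

/-- The monophonic shadow `u/v = {z | u ∈ I(z,v)}`. -/
def mShadow (G : SimpleGraph V) (u v : V) : Set V :=
  {z | u ∈ mInterval G z v}

/-- `△_uv`: the vertices `u`, `v` and their common neighbours. -/
def triangleSet (G : SimpleGraph V) (u v : V) : Set V :=
  (G.neighborSet u ∩ G.neighborSet v) ∪ {u, v}

end Monophonic

/-! ## A machine model with a step count

A program works on a graph with vertices `0, …, n-1`, given by its adjacency matrix.  It has
finitely many vertex registers (each holds a vertex), set registers (Boolean arrays of length `n`),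
pair registers (Boolean `n × n` arrays) and an output tape.  Programs are first-order syntax; they
do not depend on `n` or on the graph.  The elementary operations (one bit lookup, one comparison of
two vertices, one logical connective, one loop step) cost one step each, and everything else is
charged for all the elementary operations it performs. -/

namespace GraphProgram

/-- Boolean tests. The arguments are names of registers. -/
inductive Test : Type
  /-- the adjacency bit of the vertices in two vertex registers -/
  | adj (x y : ℕ) : Test
  /-- equality of the vertices in two vertex registers -/
  | eq (x y : ℕ) : Test
  /-- comparison of the indices of the vertices in two vertex registers -/
  | lt (x y : ℕ) : Test
  /-- the bit of set register `A` at the vertex in `x` -/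
  | mem (x A : ℕ) : Test
  /-- the bit of pair register `P` at the vertices in `x` and `y` -/
  | pair (x y P : ℕ) : Test
  | not (t : Test) : Test
  | and (t t' : Test) : Test
  | or (t t' : Test) : Test
  /-- search: let `x` run through all vertices, is `t` ever true? (`x` is local to the search) -/
  | ex (x : ℕ) (t : Test) : Test

/-- Commands. -/
inductive Cmd : Type
  | skip : Cmd
  /-- `x := y` for vertex registers -/
  | assign (x y : ℕ) : Cmd
  /-- `A := {x | t}`, where `x` is local -/
  | setOf (A x : ℕ) (t : Test) : Cmd
  /-- `P := {(x, y) | t}`, where `x` and `y` are local -/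
  | pairsOf (P x y : ℕ) (t : Test) : Cmd
  | seq (c d : Cmd) : Cmd
  | ite (t : Test) (c d : Cmd) : Cmd
  /-- for each vertex `x`, in increasing order, do `c` -/
  | forVertex (x : ℕ) (c : Cmd) : Cmd
  /-- do `c` exactly `n` times -/
  | iter (c : Cmd) : Cmd
  /-- for each subset `A` of (the initial value of) the set register `B` do `c` -/
  | forSubset (A B : ℕ) (c : Cmd) : Cmd
  /-- write the set in the register `A` to the output -/
  | print (A : ℕ) : Cmd

/-- Commands executed one after the other. -/
def Cmd.block (l : List Cmd) : Cmd := l.foldr Cmd.seq Cmd.skip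

/-- The state of the machine: registers, output (in the order in which it was written), and the
number of steps made so far. -/
@[ext]
structure Store (n : ℕ) where
  vtx : ℕ → Fin n
  set : ℕ → Finset (Fin n)
  pairs : ℕ → Finset (Fin n × Fin n)
  out : List (Finset (Fin n))
  steps : ℕ

variable {n : ℕ}

/-- Write a vertex register. -/
def Store.setVtx (s : Store n) (x : ℕ) (a : Fin n) : Store n :=
  { s with vtx := Function.update s.vtx x a }

/-- Write a set register. -/
def Store.setSet (s : Store n) (A : ℕ) (X : Finset (Fin n)) : Store n :=
  { s with set := Function.update s.set A X }

/-- Write a pair register. -/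
def Store.setPairs (s : Store n) (P : ℕ) (X : Finset (Fin n × Fin n)) : Store n :=
  { s with pairs := Function.update s.pairs P X }

/-- Count `k` steps. -/
def Store.tick (s : Store n) (k : ℕ) : Store n :=
  { s with steps := s.steps + k }

/-- The outcome of a test. -/
def Test.eval (G : SimpleGraph (Fin n)) [DecidableRel G.Adj] : Test → Store n → Bool
  | .adj x y, s => decide (G.Adj (s.vtx x) (s.vtx y))
  | .eq x y, s => decide (s.vtx x = s.vtx y)
  | .lt x y, s => decide (s.vtx x < s.vtx y)
  | .mem x A, s => decide (s.vtx x ∈ s.set A)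
  | .pair x y P, s => decide ((s.vtx x, s.vtx y) ∈ s.pairs P)
  | .not t, s => !(t.eval G s)
  | .and t t', s => t.eval G s && t'.eval G s
  | .or t t', s => t.eval G s || t'.eval G s
  | .ex x t, s => decide (∃ a : Fin n, t.eval G (s.setVtx x a) = true)

/-- The number of steps of a test on `n` vertices (no evaluation is cut short). -/
def Test.cost (n : ℕ) : Test → ℕ
  | .adj _ _ => 1
  | .eq _ _ => 1
  | .lt _ _ => 1
  | .mem _ _ => 1
  | .pair _ _ _ => 1
  | .not t => t.cost n + 1
  | .and t t' => t.cost n + t'.cost n + 1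
  | .or t t' => t.cost n + t'.cost n + 1
  | .ex _ t => n * (t.cost n + 1) + 1

/-- All subsets of `B`, each once. -/
def subsetList (B : Finset (Fin n)) : List (Finset (Fin n)) :=
  ((List.finRange n).filter (fun a => decide (a ∈ B))).sublists.map List.toFinset

/-- Execution of a command.  Each array write and each loop step is counted: a set (pair) register
is filled through a fresh array that is then copied, which is two writes per entry besides the
test; `forSubset` copies `B` first and maintains the current subset as a binary counter, which is
at most `n + 1` steps per subset; `print` writes `n` bits. -/
def Cmd.run (G : SimpleGraph (Fin n)) [DecidableRel G.Adj] : Cmd → Store n → Store n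
  | .skip, s => s.tick 1
  | .assign x y, s => (s.setVtx x (s.vtx y)).tick 1
  | .setOf A x t, s =>
      (s.setSet A (Finset.univ.filter fun a => t.eval G (s.setVtx x a) = true)).tick
        (n * (t.cost n + 2) + 1)
  | .pairsOf P x y t, s =>
      (s.setPairs P (Finset.univ.filter fun q =>
        t.eval G ((s.setVtx x q.1).setVtx y q.2) = true)).tick (n * n * (t.cost n + 2) + 1)
  | .seq c d, s => d.run G (c.run G s)
  | .ite t c d, s =>
      if t.eval G s = true then c.run G (s.tick (t.cost n + 1))
      else d.run G (s.tick (t.cost n + 1))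
  | .forVertex x c, s =>
      (List.finRange n).foldl (fun s a => c.run G ((s.setVtx x a).tick 1)) (s.tick 1)
  | .iter c, s =>
      (List.finRange n).foldl (fun s _ => c.run G (s.tick 1)) (s.tick 1)
  | .forSubset A B c, s =>
      (subsetList (s.set B)).foldl (fun s X => c.run G ((s.setSet A X).tick (n + 1)))
        (s.tick (n + 1))
  | .print A, s => { s with out := s.out ++ [s.set A], steps := s.steps + (n + 1) }

end GraphProgram

/-! ## The algorithm -/

namespace MhFptList

open GraphProgram

-- Vertex registers. The last four are used as local variables only.
abbrev u : ℕ := 0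
abbrev v : ℕ := 1
abbrev w : ℕ := 2
abbrev z : ℕ := 3
abbrev x : ℕ := 4
abbrev y : ℕ := 5
abbrev a : ℕ := 6
abbrev b : ℕ := 7

-- Set registers.
/-- holds `△_uv` -/
abbrev D : ℕ := 0
/-- one representative of each component of `¬G[△_uv]` -/
abbrev R : ℕ := 1
/-- the current subset of `R` -/
abbrev U : ℕ := 2
/-- the current labeling of `△_uv` -/
abbrev S : ℕ := 3
/-- the current candidate -/
abbrev X : ℕ := 4
/-- a single shadow -/
abbrev Y : ℕ := 5

-- Pair registers.
/-- the edges already treated (in both orientations) -/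
abbrev B : ℕ := 0
/-- the pairs joined by a walk of even length in `¬G[△_uv]` -/
abbrev Ev : ℕ := 1
/-- the pairs joined by a walk of odd length in `¬G[△_uv]` -/
abbrev Od : ℕ := 2

/-- `D := (N(u) ∩ N(v)) ∪ {u, v}` -/
def computeTriangle : Cmd :=
  .setOf D x (.or (.and (.adj u x) (.adj v x)) (.or (.eq x u) (.eq x v)))

/-- Is `{i, j}` an edge of `¬G[△_uv]`? -/
def coEdge (i j : ℕ) : Test :=
  .and (.and (.mem i D) (.mem j D)) (.and (.not (.eq i j)) (.not (.adj i j)))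

/-- One round of lengthening the walks in `¬G[△_uv]` by one and then by one more edge. -/
def parityRound : Cmd :=
  .seq (.pairsOf Od x y (.ex a (.and (.pair x a Ev) (coEdge a y))))
    (.pairsOf Ev x y (.or (.pair x y Ev) (.ex a (.and (.pair x a Od) (coEdge a y)))))

/-- Compute `Ev` and `Od`, in `2n` rounds. -/
def computeParity : Cmd :=
  .block [.pairsOf Ev x y (.and (.mem x D) (.eq x y)), .iter parityRound, .iter parityRound]

/-- `¬G[△_uv]` is bipartite: there is no closed walk of odd length. -/
def isBipartiteTest : Test := .not (.ex x (.pair x x Od))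

/-- Choose the first vertex of each component of `¬G[△_uv]`. -/
def chooseRepresentatives : Cmd :=
  .setOf R x (.and (.mem x D)
    (.not (.ex y (.and (.lt y x) (.or (.pair x y Ev) (.pair x y Od))))))

/-- For each component `C` with representative `c`, put the side of `c` into `S` if `c ∈ U`, and
the other side if `c ∉ U`. -/
def computeLabeling : Cmd :=
  .setOf S x (.ex y (.and (.mem y R)
    (.or (.and (.mem y U) (.pair y x Ev)) (.and (.not (.mem y U)) (.pair y x Od)))))

/-- The labeling separates `u` from `v`. -/
def separatesTest : Test :=
  .or (.and (.mem u S) (.not (.mem v S))) (.and (.mem v S) (.not (.mem u S)))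

/-- `w :=` the endpoint of the edge that is not in `S`. -/
def chooseEndpoint : Cmd := .ite (.mem u S) (.assign w v) (.assign w u)

/-- `Y := z/w` for a neighbour `z` of `w`: the vertices reachable from `z` by a path on which `z`
is the only vertex that equals `w` or is adjacent to `w`. -/
def computeShadow : Cmd :=
  .block [
    .setOf Y x (.eq x z),
    .iter (.setOf Y x (.or (.mem x Y)
      (.and (.and (.not (.eq x w)) (.not (.adj x w)))
        (.ex y (.and (.mem y Y) (.adj y x))))))]

/-- `X :=` the union of the shadows `z/w` over all `z ∈ S`. -/
def computeUnionOfShadows : Cmd :=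
  .block [
    .setOf X x (.not (.eq x x)),
    .forVertex z (.ite (.mem z S)
      (.seq computeShadow (.setOf X x (.or (.mem x X) (.mem x Y)))) .skip)]

/-- `X` and its complement are m-convex, tested as: the border of `X` and the border of its
complement are cliques. -/
def isHalfspaceTest : Test :=
  .and
    (.not (.ex x (.ex y (.and
      (.and (.and (.mem x X) (.mem y X)) (.and (.not (.eq x y)) (.not (.adj x y))))
      (.and (.ex a (.and (.not (.mem a X)) (.adj x a)))
        (.ex b (.and (.not (.mem b X)) (.adj y b))))))))
    (.not (.ex x (.ex y (.and
      (.and (.and (.not (.mem x X)) (.not (.mem y X))) (.and (.not (.eq x y)) (.not (.adj x y))))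
      (.and (.ex a (.and (.mem a X) (.adj x a)))
        (.ex b (.and (.mem b X) (.adj y b))))))))

/-- `δ(X) ∩ B = ∅` -/
def avoidsTreatedEdges : Test :=
  .not (.ex x (.ex y (.and (.and (.mem x X) (.not (.mem y X)))
    (.and (.adj x y) (.pair x y B)))))

/-- The body of the loop over the subsets `U ⊆ R`. -/
def trySubset : Cmd :=
  .seq computeLabeling
    (.ite separatesTest
      (.block [
        chooseEndpoint,
        computeUnionOfShadows,
        .ite (.and isHalfspaceTest avoidsTreatedEdges) (.print X) .skip])
      .skip)

/-- `B := B ∪ {{u, v}}` -/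
def markEdge : Cmd :=
  .pairsOf B x y (.or (.pair x y B)
    (.or (.and (.eq x u) (.eq y v)) (.and (.eq x v) (.eq y u))))

/-- The body of the loop over the edges `{u, v}`. -/
def treatEdge : Cmd :=
  .block [
    computeTriangle,
    computeParity,
    .ite isBipartiteTest
      (.block [chooseRepresentatives, .forSubset U R trySubset, markEdge])
      .skip]

end MhFptList

open GraphProgram MhFptList in
/-- The listing algorithm: print `∅` and `V`, then treat every edge `{u, v}` once. -/
def mhFptList : Cmd :=
  .block [
    .pairsOf B x y (.not (.eq x x)),
    .setOf X x (.not (.eq x x)),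
    .print X,
    .setOf X x (.eq x x),
    .print X,
    .forVertex u (.forVertex v
      (.ite (.and (.adj u v) (.lt u v)) treatEdge .skip))]

/-! In a connected graph, `X` is an m-halfspace iff the border of `X` and the border of its
complement are cliques (`isMHalfspace_iff`); this makes halfspaces testable in polynomial time.

Let an edge `uv` leave a halfspace `H`, with `u ∈ H`. Two nonadjacent vertices `x, y` of `△_uv` are
common neighbours of `u` and `v`, so `x-u-y` and `x-v-y` are induced. Hence `x, y` cannot both lie
in `H`, nor both outside, and `H` 2-colours `¬G[△_uv]` (`IsMHalfspace.mem_iff_notMem`). Moreover `H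
∩ △_uv` determines `H`: on a path inside `H` from `u` to `x`, let `z` be the last neighbour of `v`.
Then `x ∈ z/v`, and `z ∈ △_uv` because `z` and `u` are both border vertices of `H`
(`IsMHalfspace.eq_iUnion_mShadow`).

So the halfspaces cutting `uv` are found among the candidates given by the choices of one side per
component of `¬G[△_uv]`. Representatives of distinct components are adjacent in `G`, so there are at
most `2 ^ ω` choices (`IsParity.isClique_representatives`).

No set is printed twice. For one edge, a candidate meets `△_uv` exactly in its labeling
(`candidate_inter`), and the labeling meets `R` exactly in `U` (`IsParity.labeling_inter`). Across
edges, the test against `B` rejects halfspaces cut by an earlier edge. Edges that fail the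
bipartiteness test never enter `B`, but no halfspace cuts them. By connectivity every halfspace
other than `∅` and `V` cuts some edge, so none is missed.

The program computes parities of walks and shadows by iterating inflationary maps, which stabilize
after `n` rounds. Everything but the single loop over subsets costs polynomially many steps. -/

/-! ## Induced paths -/

namespace SimpleGraph.Walk

variable {V : Type*} {G : SimpleGraph V}

/-- A path without chords. -/
def IsInducedPath {u v : V} (p : G.Walk u v) : Prop :=
  p.IsPath ∧ p.IsChordless

theorem isInducedPath_nil {u : V} : (nil : G.Walk u u).IsInducedPath := by
  refine ⟨IsPath.nil, isChordless_iff_forall_mem_edges.mpr ?_⟩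
  intro a b ha hb hab
  simp only [support_nil, List.mem_singleton] at ha hb
  subst ha hb
  exact absurd rfl hab.ne

/-- This recursive form lets later inductions along a walk avoid handling chords directly. -/
theorem isInducedPath_cons_iff {u v w : V} {h : G.Adj u v} {p : G.Walk v w} :
    (cons h p).IsInducedPath ↔
      p.IsInducedPath ∧ u ∉ p.support ∧ ∀ x ∈ p.support, G.Adj u x → x = v := by
  unfold IsInducedPath
  simp only [isChordless_iff_forall_mem_edges, cons_isPath_iff, support_cons, edges_cons,
    List.mem_cons]
  constructor
  · rintro ⟨⟨hp, hu⟩, hc⟩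
    refine ⟨⟨hp, fun a b ha hb hab => ?_⟩, hu, fun x hx hux => ?_⟩
    · rcases hc (Or.inr ha) (Or.inr hb) hab with h' | h'
      · rw [Sym2.eq_iff] at h'
        rcases h' with ⟨rfl, -⟩ | ⟨-, rfl⟩
        · exact absurd ha hu
        · exact absurd hb hu
      · exact h'
    · rcases hc (Or.inl rfl) (Or.inr hx) hux with h' | h'
      · rw [Sym2.eq_iff] at h'
        rcases h' with ⟨-, h'⟩ | ⟨h', -⟩
        · exact h'
        · exact absurd h' h.ne
      · exact absurd (p.fst_mem_support_of_mem_edges h') hu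
  · rintro ⟨⟨hp, hc⟩, hu, hx⟩
    refine ⟨⟨hp, hu⟩, ?_⟩
    rintro a b (rfl | ha) (rfl | hb) hab
    · exact absurd rfl hab.ne
    · exact Or.inl (by rw [hx b hb hab])
    · exact Or.inl (by rw [hx a ha hab.symm, Sym2.eq_swap])
    · exact Or.inr (hc ha hb hab)

theorem IsInducedPath.reverse {u v : V} {p : G.Walk u v} (hp : p.IsInducedPath) :
    p.reverse.IsInducedPath := by
  refine ⟨hp.1.reverse, isChordless_iff_forall_mem_edges.mpr fun a b ha hb hab => ?_⟩
  rw [support_reverse, List.mem_reverse] at ha hb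
  rw [edges_reverse, List.mem_reverse]
  exact hp.2.mem_edges ha hb hab

/-- Attach `u` at the last vertex of `p` that equals `u` or is adjacent to it; the remaining tail
then has no chord to `u`. -/
theorem IsInducedPath.exists_of_mem_or_adj {u v w : V} {p : G.Walk v w} (hp : p.IsInducedPath)
    (hu : u ∈ p.support ∨ ∃ x ∈ p.support, G.Adj u x) :
    ∃ q : G.Walk u w, q.IsInducedPath ∧ ∀ x ∈ q.support, x = u ∨ x ∈ p.support := by
  induction p with
  | nil =>
    simp only [support_nil, List.mem_singleton, exists_eq_left] at hu ⊢
    rcases hu with rfl | hu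
    · exact ⟨nil, hp, by simp⟩
    · exact ⟨cons hu nil, isInducedPath_cons_iff.mpr ⟨hp, by simpa using hu.ne, by simp⟩, by simp⟩
  | @cons a b c h p ih =>
    by_cases hu' : u ∈ p.support ∨ ∃ x ∈ p.support, G.Adj u x
    · obtain ⟨q, hq, hqs⟩ := ih (isInducedPath_cons_iff.mp hp).1 hu'
      refine ⟨q, hq, fun x hx => (hqs x hx).imp_right fun hx => ?_⟩
      exact List.mem_cons_of_mem _ hx
    · push Not at hu'
      by_cases hua : u = a
      · subst hua
        exact ⟨cons h p, hp, fun x hx => Or.inr hx⟩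
      · have hadj : G.Adj u a := by
          simp only [support_cons, List.mem_cons] at hu
          grind
        refine ⟨cons hadj (cons h p), isInducedPath_cons_iff.mpr ⟨hp, ?_, ?_⟩, by simp⟩
        · simp [hua, hu'.1]
        · intro x hx hux
          rw [support_cons, List.mem_cons] at hx
          exact hx.resolve_right fun hx => hu'.2 x hx hux

theorem exists_isInducedPath {u v : V} (p : G.Walk u v) :
    ∃ q : G.Walk u v, q.IsInducedPath ∧ ∀ x ∈ q.support, x ∈ p.support := by
  induction p with
  | nil => exact ⟨nil, isInducedPath_nil, by simp⟩
  | @cons a b c h p ih =>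
    obtain ⟨q, hq, hqs⟩ := ih
    obtain ⟨r, hr, hrs⟩ := hq.exists_of_mem_or_adj (Or.inr ⟨b, q.start_mem_support, h⟩)
    refine ⟨r, hr, fun x hx => ?_⟩
    rw [support_cons, List.mem_cons]
    exact (hrs x hx).imp_right (hqs x)

theorem exists_adj_of_notMem_of_mem {X : Set V} {u v : V} (p : G.Walk u v) (hu : u ∉ X)
    (hv : v ∈ X) : ∃ b ∈ p.support, b ∈ X ∧ ∃ c, c ∉ X ∧ G.Adj b c := by
  induction p with
  | nil => exact absurd hv hu
  | @cons a b c h p ih =>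
    by_cases hb : b ∈ X
    · exact ⟨b, by simp, hb, a, hu, h.symm⟩
    · obtain ⟨d, hd, hd'⟩ := ih hb hv
      exact ⟨d, List.mem_cons_of_mem _ hd, hd'⟩

end SimpleGraph.Walk

/-! ## Monophonic intervals, shadows and halfspaces -/

section Monophonic

open SimpleGraph

variable {V : Type*} {G : SimpleGraph V}

theorem mem_mInterval {u v z : V} :
    z ∈ mInterval G u v ↔ u ≠ v ∧ ∃ p : G.Walk u v, p.IsInducedPath ∧ z ∈ p.support := by
  simp [mInterval, Walk.IsInducedPath, and_assoc]

theorem mInterval_comm (u v : V) : mInterval G u v = mInterval G v u := by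
  have key : ∀ u v : V, mInterval G u v ⊆ mInterval G v u := by
    intro u v z hz
    rw [mem_mInterval] at hz ⊢
    obtain ⟨h, p, hp, hz⟩ := hz
    exact ⟨h.symm, p.reverse, hp.reverse, by simpa using hz⟩
  exact (key u v).antisymm (key v u)

/-- The vertices of `X` with a neighbour outside `X` form a clique. -/
def HasCliqueBorder (G : SimpleGraph V) (X : Set V) : Prop :=
  ∀ x ∈ X, ∀ y ∈ X, x ≠ y → ¬ G.Adj x y →
    (∃ a, a ∉ X ∧ G.Adj x a) → ¬ ∃ b, b ∉ X ∧ G.Adj y b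

/-- If an induced path left `X` on its first step, it would later re-enter at a border vertex `d`.
The clique condition makes `d` adjacent to the start, which is a chord. -/
theorem HasCliqueBorder.support_subset {X : Set V} (hX : HasCliqueBorder G X) {x y : V}
    (hx : x ∈ X) (hy : y ∈ X) {p : G.Walk x y} (hp : p.IsInducedPath) :
    ∀ z ∈ p.support, z ∈ X := by
  induction p with
  | nil => simpa using hx
  | @cons a b c h p ih =>
    obtain ⟨hp, ha, hadj⟩ := Walk.isInducedPath_cons_iff.mp hp
    have hb : b ∈ X := by
      by_contra hb
      obtain ⟨d, hd, hdX, hd'⟩ := p.exists_adj_of_notMem_of_mem hb hy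
      refine hX a hx d hdX (fun h => ha (h ▸ hd)) (fun h => hb ?_) ⟨b, hb, h⟩ hd'
      rwa [← hadj d hd h]
    simpa [hx] using ih hb hy hp

theorem HasCliqueBorder.isMConvex {X : Set V} (hX : HasCliqueBorder G X) : IsMConvex G X := by
  intro x hx y hy z hz
  obtain ⟨-, p, hp, hz⟩ := mem_mInterval.mp hz
  exact hX.support_subset hx hy hp z hz

/-- The convention `I(x,x) = ∅` forces a separate case: an induced path from `x` to itself is
trivial. -/
theorem IsMConvex.support_subset {X : Set V} (hX : IsMConvex G X) {x y : V}
    (hx : x ∈ X) (hy : y ∈ X) {p : G.Walk x y} (hp : p.IsInducedPath) :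
    ∀ z ∈ p.support, z ∈ X := by
  intro z hz
  by_cases hxy : x = y
  · subst hxy
    cases p with
    | nil =>
      rw [Walk.support_nil, List.mem_singleton] at hz
      rwa [hz]
    | cons h p => exact absurd p.end_mem_support (Walk.isInducedPath_cons_iff.mp hp).2.1
  · exact hX x hx y hy (mem_mInterval.mpr ⟨hxy, p, hp, hz⟩)

theorem IsMConvex.exists_walk {X : Set V} (hG : G.Connected) (hX : IsMConvex G X) {x y : V}
    (hx : x ∈ X) (hy : y ∈ X) : ∃ p : G.Walk x y, ∀ z ∈ p.support, z ∈ X := by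
  obtain ⟨p⟩ := hG.preconnected x y
  obtain ⟨q, hq, -⟩ := p.exists_isInducedPath
  exact ⟨q, hX.support_subset hx hy hq⟩

/-- Join the outer neighbours `a`, `b` inside the complement and shorten `x-a-…-b-y` to an induced
path. Its second vertex lies in `X` by convexity, so it can only be `y`. -/
theorem IsMConvex.hasCliqueBorder {X : Set V} (hG : G.Connected) (hX : IsMConvex G X)
    (hXc : IsMConvex G Xᶜ) : HasCliqueBorder G X := by
  rintro x hx y hy hxy hadj ⟨a, ha, hxa⟩ ⟨b, hb, hyb⟩
  obtain ⟨p, hp⟩ := hXc.exists_walk hG ha hb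
  obtain ⟨q, hq, hqs⟩ := (Walk.cons hxa (p.concat hyb.symm)).exists_isInducedPath
  have hsub := hX.support_subset hx hy hq
  cases q with
  | nil => exact hxy rfl
  | @cons _ c _ h q =>
    have hc := hqs c (by simp)
    simp only [Walk.support_cons, Walk.support_concat, List.mem_cons,
      List.mem_append, List.not_mem_nil, or_false] at hc
    rcases hc with rfl | hc | rfl
    · exact h.ne rfl
    · exact hp c hc (hsub c (by simp))
    · exact hadj h

theorem isMHalfspace_iff (hG : G.Connected) {X : Set V} :
    IsMHalfspace G X ↔ HasCliqueBorder G X ∧ HasCliqueBorder G Xᶜ :=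
  ⟨fun h => ⟨h.1.hasCliqueBorder hG h.2, h.2.hasCliqueBorder hG (by rw [compl_compl]; exact h.1)⟩,
    fun h => ⟨h.1.isMConvex, h.2.isMConvex⟩⟩

/-- An induced path starting at `w` contains only one neighbour of `w`, its second vertex, so
deleting `w` leaves a path starting at `z`. Conversely any such walk can be shortened to an induced
path and `w` put in front, so shadows reduce to graph search. -/
theorem mem_mShadow_iff {z w x : V} (hzw : G.Adj z w) :
    x ∈ mShadow G z w ↔
      ∃ p : G.Walk z x, ∀ a ∈ p.support, a = z ∨ (a ≠ w ∧ ¬ G.Adj a w) := by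
  change z ∈ mInterval G x w ↔ _
  rw [mInterval_comm, mem_mInterval]
  constructor
  · rintro ⟨hwx, p, hp, hz⟩
    cases p with
    | nil => exact absurd rfl hwx
    | @cons _ c _ h p =>
      obtain ⟨hp, hw, hadj⟩ := Walk.isInducedPath_cons_iff.mp hp
      have hz : z ∈ p.support := by
        rw [Walk.support_cons, List.mem_cons] at hz
        exact hz.resolve_left hzw.ne
      obtain rfl := hadj z hz hzw.symm
      refine ⟨p, fun a ha => or_iff_not_imp_left.mpr fun haz => ⟨?_, fun h => ?_⟩⟩
      · rintro rfl
        exact hw ha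
      · exact haz (hadj a ha h.symm)
  · rintro ⟨p, hp⟩
    obtain ⟨q, hq, hqs⟩ := p.exists_isInducedPath
    have hw : w ∉ q.support := by
      intro hw
      rcases hp w (hqs w hw) with h | h
      · exact hzw.ne h.symm
      · exact h.1 rfl
    refine ⟨?_, Walk.cons hzw.symm q, Walk.isInducedPath_cons_iff.mpr ⟨hq, hw, ?_⟩, by simp⟩
    · rintro rfl
      exact hw q.end_mem_support
    · intro a ha hwa
      exact (hp a (hqs a ha)).resolve_right fun h => h.2 hwa.symm

theorem self_mem_mShadow {z w : V} (hzw : G.Adj z w) : z ∈ mShadow G z w :=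
  (mem_mShadow_iff hzw).mpr ⟨Walk.nil, by simp⟩

theorem eq_of_mem_mShadow {x z w : V} (hzw : G.Adj z w) (hxw : G.Adj x w)
    (h : x ∈ mShadow G z w) : x = z := by
  obtain ⟨p, hp⟩ := (mem_mShadow_iff hzw).mp h
  exact (hp x p.end_mem_support).resolve_right fun h => h.2 hxw

theorem notMem_mShadow_self {z w : V} : w ∉ mShadow G z w :=
  fun h => (mem_mInterval.mp h).1 rfl

theorem triangleSet_comm (u v : V) : triangleSet G u v = triangleSet G v u := by
  ext x
  simp only [triangleSet, Set.mem_union, Set.mem_inter_iff, Set.mem_insert_iff,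
    Set.mem_singleton_iff]
  tauto

theorem adj_of_mem_triangleSet {u v x : V} (huv : G.Adj u v) (hx : x ∈ triangleSet G u v)
    (hxv : x ≠ v) : G.Adj x v := by
  rcases hx with hx | rfl | rfl
  · exact hx.2.symm
  · exact huv
  · exact absurd rfl hxv

theorem IsMHalfspace.mem_iff_notMem {H : Set V} (hH : IsMHalfspace G H) {u v : V}
    (huv : G.Adj u v) (hu : u ∈ H) (hv : v ∉ H) {x y : V} (hx : x ∈ triangleSet G u v)
    (hy : y ∈ triangleSet G u v) (hxy : x ≠ y) (hadj : ¬ G.Adj x y) : x ∈ H ↔ y ∉ H := by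
  have key : ∀ w : V, G.Adj x w → G.Adj y w → w ∈ mInterval G x y := by
    intro w hxw hyw
    refine mem_mInterval.mpr ⟨hxy, Walk.cons hxw (Walk.cons hyw.symm Walk.nil), ?_, by simp⟩
    rw [Walk.isInducedPath_cons_iff, Walk.isInducedPath_cons_iff]
    refine ⟨⟨Walk.isInducedPath_nil, by simpa using hyw.ne.symm, by simp⟩, ?_, ?_⟩
    · simp [hxy, hxw.ne]
    · simp [hadj]
  -- Each of `u`, `v` is adjacent to all other vertices of `△_uv`, so neither belongs to a
  -- nonadjacent pair.
  have hxu : G.Adj x v := adj_of_mem_triangleSet huv hx <| by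
    rintro rfl
    exact hadj (adj_of_mem_triangleSet huv hy hxy.symm).symm
  have hyu : G.Adj y v := adj_of_mem_triangleSet huv hy <| by
    rintro rfl
    exact hadj hxu
  rw [triangleSet_comm] at hx hy
  have hxv : G.Adj x u := adj_of_mem_triangleSet huv.symm hx <| by
    rintro rfl
    exact hadj (adj_of_mem_triangleSet huv.symm hy hxy.symm).symm
  have hyv : G.Adj y u := adj_of_mem_triangleSet huv.symm hy <| by
    rintro rfl
    exact hadj hxv
  constructor
  · intro hxH hyH
    exact hv (hH.1 x hxH y hyH (key v hxu hyu))
  · intro hyH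
    by_contra hxH
    exact hH.2 x hxH y hyH (key u hxv hyv) hu

theorem IsMHalfspace.isBipartite {H : Set V} (hH : IsMHalfspace G H) {u v : V}
    (huv : G.Adj u v) (hu : u ∈ H) (hv : v ∉ H) :
    ((G.induce (triangleSet G u v))ᶜ).IsBipartite := by
  classical
  refine ⟨SimpleGraph.Coloring.mk (fun x => if (x : V) ∈ H then 0 else 1) ?_⟩
  rintro ⟨x, hx⟩ ⟨y, hy⟩ hxy
  simp only [compl_adj, ne_eq, Subtype.mk.injEq, comap_adj, Function.Embedding.subtype_apply] at hxy
  have := hH.mem_iff_notMem huv hu hv hx hy hxy.1 hxy.2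
  by_cases hyH : y ∈ H <;> simp_all

theorem IsMHalfspace.eq_iUnion_mShadow (hG : G.Connected) {H : Set V} (hH : IsMHalfspace G H)
    {u v : V} (huv : G.Adj u v) (hu : u ∈ H) (hv : v ∉ H) :
    H = ⋃ z ∈ triangleSet G u v ∩ H, mShadow G z v := by
  ext x
  simp only [Set.mem_iUnion, exists_prop]
  constructor
  · intro hx
    -- Working from the end `x` backwards, the first neighbour of `v` met is the required `z`.
    have key : ∀ (a : V) (p : G.Walk a x), (∀ b ∈ p.support, b ∈ H) →
        (∀ b ∈ p.support, ¬ G.Adj b v) ∨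
          ∃ z, z ∈ H ∧ G.Adj z v ∧ x ∈ mShadow G z v := by
      intro a p
      induction p with
      | nil =>
        rename_i a
        intro ha
        by_cases hav : G.Adj a v
        · exact Or.inr ⟨a, ha a (by simp), hav, self_mem_mShadow hav⟩
        · exact Or.inl (by simpa using hav)
      | @cons a b c h p ih =>
        intro ha
        rcases ih hx (fun b hb => ha b (List.mem_cons_of_mem _ hb)) with h' | h'
        · by_cases hav : G.Adj a v
          · refine Or.inr ⟨a, ha a (by simp), hav, (mem_mShadow_iff hav).mpr ⟨Walk.cons h p, ?_⟩⟩
            intro d hd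
            have hdH := ha d hd
            rw [Walk.support_cons, List.mem_cons] at hd
            exact hd.imp_right fun hd => ⟨fun e => hv (e ▸ hdH), h' d hd⟩
          · refine Or.inl fun d hd => ?_
            rw [Walk.support_cons, List.mem_cons] at hd
            rcases hd with rfl | hd
            · exact hav
            · exact h' d hd
        · exact Or.inr h'
    obtain ⟨p, hp⟩ := hH.1.exists_walk hG hu hx
    rcases key u p hp with h | ⟨z, hzH, hzv, hxz⟩
    · exact absurd huv (h u p.start_mem_support)
    · refine ⟨z, ⟨?_, hzH⟩, hxz⟩
      by_cases hzu : z = u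
      · exact Or.inr (Or.inl hzu)
      · refine Or.inl ⟨?_, hzv.symm⟩
        -- Both `u` and `z` are border vertices of `H`, having `v` as a neighbour outside.
        by_contra huz
        exact hH.1.hasCliqueBorder hG hH.2 u hu z hzH (Ne.symm hzu) huz ⟨v, hv, huv⟩ ⟨v, hv, hzv⟩
  · rintro ⟨z, ⟨-, hzH⟩, hxz⟩
    by_contra hx
    exact hH.2 x hx v hv hxz hzH

end Monophonic

/-! ## Inflationary maps and folds -/

/-- Every round before stabilization adds an element, and there are only `Fintype.card α` elements
to add. -/
theorem Function.IsFixedPt.iterate_of_le_card {α : Type*} [Fintype α] [DecidableEq α]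
    {f : Finset α → Finset α} (hf : ∀ S, S ⊆ f S) (S : Finset α) {k : ℕ}
    (hk : Fintype.card α ≤ k) : Function.IsFixedPt f (f^[k] S) := by
  have key : ∀ m : ℕ, Function.IsFixedPt f (f^[m] S) ∨ m + 1 ≤ (f^[m + 1] S).card := by
    intro m
    induction m with
    | zero =>
      refine or_iff_not_imp_left.mpr fun h => ?_
      have : S ⊂ f S := (hf S).ssubset_of_ne fun e => h e.symm
      have := Finset.card_lt_card this
      simp only [zero_add, Function.iterate_one]
      omega
    | succ m ih =>
      refine or_iff_not_imp_left.mpr fun h => ?_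
      have h0 : ¬ Function.IsFixedPt f (f^[m] S) := by
        intro h0
        apply h
        rw [Function.iterate_succ_apply', h0.eq]
        exact h0
      have hlt : f^[m + 1] S ⊂ f (f^[m + 1] S) := (hf _).ssubset_of_ne fun e => h e.symm
      have := Finset.card_lt_card hlt
      rw [Function.iterate_succ_apply']
      have := ih.resolve_left h0
      omega
  refine (key k).resolve_right fun h => ?_
  have := Finset.card_le_univ (f^[k + 1] S)
  omega

theorem List.foldl_induction {α β : Type*} {f : β → α → β} {p : β → Prop} {l : List α} {b : β}
    (h0 : p b) (h : ∀ b, p b → ∀ a ∈ l, p (f b a)) : p (l.foldl f b) := by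
  induction l generalizing b with
  | nil => exact h0
  | cons a l ih =>
    exact ih (h b h0 a (by simp)) fun b hb c hc => h b hb c (by simp [hc])

theorem List.foldl_induction_length {α β : Type*} {f : β → α → β} {p : ℕ → β → Prop} {l : List α}
    {b : β} {k : ℕ} (h0 : p k b) (h : ∀ k b a, p k b → p (k + 1) (f b a)) :
    p (k + l.length) (l.foldl f b) := by
  induction l generalizing b k with
  | nil => exact h0
  | cons a l ih =>
    have := ih (h k b a h0)
    rwa [List.length_cons, Nat.add_comm l.length, ← Nat.add_assoc]

/-- For loops in which each round achieves a goal `done a` of its own that later rounds must not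
destroy. -/
theorem List.foldl_induction_done {α β : Type*} {f : β → α → β} {p : β → Prop}
    {done : α → β → Prop} {l : List α} {b : β} (h0 : p b)
    (h : ∀ b, p b → ∀ a ∈ l, p (f b a) ∧ done a (f b a) ∧ ∀ c, done c b → done c (f b a)) :
    p (l.foldl f b) ∧ (∀ a ∈ l, done a (l.foldl f b)) ∧ ∀ c, done c b → done c (l.foldl f b) := by
  induction l generalizing b with
  | nil => exact ⟨h0, by simp, fun _ h => h⟩
  | cons a l ih =>
    obtain ⟨h1, h2, h3⟩ := h b h0 a (by simp)
    obtain ⟨h4, h5, h6⟩ := ih h1 fun b hb c hc => h b hb c (by simp [hc])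
    refine ⟨h4, ?_, fun c hc => h6 c (h3 c hc)⟩
    intro c hc
    rcases List.mem_cons.mp hc with rfl | hc
    · exact h6 c h2
    · exact h5 c hc

/-! ## Registers and steps of a program -/

namespace GraphProgram

open Polynomial

variable {n : ℕ}

/-- The vertex registers that a command may change. -/
def Cmd.vtxWrites : Cmd → List ℕ
  | .assign x _ => [x]
  | .seq c d => c.vtxWrites ++ d.vtxWrites
  | .ite _ c d => c.vtxWrites ++ d.vtxWrites
  | .forVertex x c => x :: c.vtxWrites
  | .iter c => c.vtxWrites
  | .forSubset _ _ c => c.vtxWrites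
  | _ => []

/-- The set registers that a command may change. -/
def Cmd.setWrites : Cmd → List ℕ
  | .setOf A _ _ => [A]
  | .seq c d => c.setWrites ++ d.setWrites
  | .ite _ c d => c.setWrites ++ d.setWrites
  | .forVertex _ c => c.setWrites
  | .iter c => c.setWrites
  | .forSubset A _ c => A :: c.setWrites
  | _ => []

/-- The pair registers that a command may change. -/
def Cmd.pairWrites : Cmd → List ℕ
  | .pairsOf P _ _ _ => [P]
  | .seq c d => c.pairWrites ++ d.pairWrites
  | .ite _ c d => c.pairWrites ++ d.pairWrites
  | .forVertex _ c => c.pairWrites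
  | .iter c => c.pairWrites
  | .forSubset _ _ c => c.pairWrites
  | _ => []

/-- The command contains no `print`. -/
def Cmd.silent : Cmd → Bool
  | .seq c d => c.silent && d.silent
  | .ite _ c d => c.silent && d.silent
  | .forVertex _ c => c.silent
  | .iter c => c.silent
  | .forSubset _ _ c => c.silent
  | .print _ => false
  | _ => true

/-- The command contains no loop over subsets. -/
def Cmd.subsetFree : Cmd → Bool
  | .seq c d => c.subsetFree && d.subsetFree
  | .ite _ c d => c.subsetFree && d.subsetFree
  | .forVertex _ c => c.subsetFree
  | .iter c => c.subsetFree
  | .forSubset _ _ _ => false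
  | _ => true

/-! ### Frame properties: what a command leaves unchanged, read off from its syntax. -/

variable (G : SimpleGraph (Fin n)) [DecidableRel G.Adj]

theorem Cmd.run_vtx {c : Cmd} {x : ℕ} (hx : x ∉ c.vtxWrites) (s : Store n) :
    (c.run G s).vtx x = s.vtx x := by
  induction c generalizing s with
  | skip | setOf | pairsOf | print => rfl
  | assign y z =>
    simp only [vtxWrites, List.mem_singleton] at hx
    simp [Cmd.run, Store.tick, Store.setVtx, hx]
  | seq c d ihc ihd =>
    simp only [vtxWrites, List.mem_append, not_or] at hx
    rw [Cmd.run, ihd hx.2, ihc hx.1]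
  | ite t c d ihc ihd =>
    simp only [vtxWrites, List.mem_append, not_or] at hx
    rw [Cmd.run]
    split_ifs
    · rw [ihc hx.1]; rfl
    · rw [ihd hx.2]; rfl
  | forVertex y c ih =>
    simp only [vtxWrites, List.mem_cons, not_or] at hx
    rw [Cmd.run]
    refine List.foldl_induction (p := fun s' : Store n => s'.vtx x = s.vtx x) rfl fun b hb a _ => ?_
    rw [ih hx.2, ← hb]
    simp [Store.tick, Store.setVtx, hx.1]
  | iter c ih =>
    rw [Cmd.run]
    refine List.foldl_induction (p := fun s' : Store n => s'.vtx x = s.vtx x) rfl fun b hb a _ => ?_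
    rw [ih hx, ← hb]; rfl
  | forSubset A B c ih =>
    rw [Cmd.run]
    refine List.foldl_induction (p := fun s' : Store n => s'.vtx x = s.vtx x) rfl fun b hb a _ => ?_
    rw [ih hx, ← hb]; rfl

theorem Cmd.run_set {c : Cmd} {A : ℕ} (hA : A ∉ c.setWrites) (s : Store n) :
    (c.run G s).set A = s.set A := by
  induction c generalizing s with
  | skip | assign | pairsOf | print => rfl
  | setOf A' z t =>
    simp only [setWrites, List.mem_singleton] at hA
    simp [Cmd.run, Store.tick, Store.setSet, hA]
  | seq c d ihc ihd =>
    simp only [setWrites, List.mem_append, not_or] at hA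
    rw [Cmd.run, ihd hA.2, ihc hA.1]
  | ite t c d ihc ihd =>
    simp only [setWrites, List.mem_append, not_or] at hA
    rw [Cmd.run]
    split_ifs
    · rw [ihc hA.1]; rfl
    · rw [ihd hA.2]; rfl
  | forVertex y c ih =>
    rw [Cmd.run]
    refine List.foldl_induction (p := fun s' : Store n => s'.set A = s.set A) rfl fun b hb a _ => ?_
    rw [ih hA, ← hb]; rfl
  | iter c ih =>
    rw [Cmd.run]
    refine List.foldl_induction (p := fun s' : Store n => s'.set A = s.set A) rfl fun b hb a _ => ?_
    rw [ih hA, ← hb]; rfl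
  | forSubset A' B c ih =>
    simp only [setWrites, List.mem_cons, not_or] at hA
    rw [Cmd.run]
    refine List.foldl_induction (p := fun s' : Store n => s'.set A = s.set A) rfl fun b hb a _ => ?_
    rw [ih hA.2, ← hb]
    simp [Store.tick, Store.setSet, hA.1]

theorem Cmd.run_pairs {c : Cmd} {P : ℕ} (hP : P ∉ c.pairWrites) (s : Store n) :
    (c.run G s).pairs P = s.pairs P := by
  induction c generalizing s with
  | skip | assign | setOf | print => rfl
  | pairsOf P' y z t =>
    simp only [pairWrites, List.mem_singleton] at hP
    simp [Cmd.run, Store.tick, Store.setPairs, hP]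
  | seq c d ihc ihd =>
    simp only [pairWrites, List.mem_append, not_or] at hP
    rw [Cmd.run, ihd hP.2, ihc hP.1]
  | ite t c d ihc ihd =>
    simp only [pairWrites, List.mem_append, not_or] at hP
    rw [Cmd.run]
    split_ifs
    · rw [ihc hP.1]; rfl
    · rw [ihd hP.2]; rfl
  | forVertex y c ih =>
    rw [Cmd.run]
    refine List.foldl_induction (p := fun s' : Store n => s'.pairs P = s.pairs P) rfl fun b hb a _ => ?_
    rw [ih hP, ← hb]; rfl
  | iter c ih =>
    rw [Cmd.run]
    refine List.foldl_induction (p := fun s' : Store n => s'.pairs P = s.pairs P) rfl fun b hb a _ => ?_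
    rw [ih hP, ← hb]; rfl
  | forSubset A' B c ih =>
    rw [Cmd.run]
    refine List.foldl_induction (p := fun s' : Store n => s'.pairs P = s.pairs P) rfl fun b hb a _ => ?_
    rw [ih hP, ← hb]; rfl

theorem Cmd.run_out {c : Cmd} (hc : c.silent = true) (s : Store n) :
    (c.run G s).out = s.out := by
  induction c generalizing s with
  | skip | assign | setOf | pairsOf => rfl
  | print => simp [silent] at hc
  | seq c d ihc ihd =>
    simp only [silent, Bool.and_eq_true] at hc
    rw [Cmd.run, ihd hc.2, ihc hc.1]
  | ite t c d ihc ihd =>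
    simp only [silent, Bool.and_eq_true] at hc
    rw [Cmd.run]
    split_ifs
    · rw [ihc hc.1]; rfl
    · rw [ihd hc.2]; rfl
  | forVertex y c ih =>
    rw [Cmd.run]
    refine List.foldl_induction (p := fun s' : Store n => s'.out = s.out) rfl fun b hb a _ => ?_
    rw [ih hc, ← hb]; rfl
  | iter c ih =>
    rw [Cmd.run]
    refine List.foldl_induction (p := fun s' : Store n => s'.out = s.out) rfl fun b hb a _ => ?_
    rw [ih hc, ← hb]; rfl
  | forSubset A' B c ih =>
    rw [Cmd.run]
    refine List.foldl_induction (p := fun s' : Store n => s'.out = s.out) rfl fun b hb a _ => ?_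
    rw [ih hc, ← hb]; rfl

/-- The cost of a test as a polynomial in the number of vertices. -/
noncomputable def Test.costPoly : Test → ℕ[X]
  | .not t => t.costPoly + 1
  | .and t t' => t.costPoly + t'.costPoly + 1
  | .or t t' => t.costPoly + t'.costPoly + 1
  | .ex _ t => X * (t.costPoly + 1) + 1
  | _ => 1

theorem Test.costPoly_eval (t : Test) : t.costPoly.eval n = t.cost n := by
  induction t <;> simp_all [Test.costPoly, Test.cost]

/-- A bound on the number of steps, where a loop over subsets counts for one round. -/
noncomputable def Cmd.stepPoly : Cmd → ℕ[X]
  | .skip => 1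
  | .assign _ _ => 1
  | .setOf _ _ t => X * (t.costPoly + 2) + 1
  | .pairsOf _ _ _ t => X * X * (t.costPoly + 2) + 1
  | .seq c d => c.stepPoly + d.stepPoly
  | .ite t c d => t.costPoly + 1 + c.stepPoly + d.stepPoly
  | .forVertex _ c => 1 + X * (1 + c.stepPoly)
  | .iter c => 1 + X * (1 + c.stepPoly)
  | .forSubset _ _ c => (X + 1) + (X + 1 + c.stepPoly)
  | .print _ => X + 1

/-- The number of steps is at most `M` times the bound `stepPoly`. -/
def Cmd.IsBounded (M : ℕ) (c : Cmd) : Prop :=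
  ∀ s : Store n, (c.run G s).steps ≤ s.steps + M * c.stepPoly.eval n

variable {G} {M : ℕ}

theorem foldl_steps_le {α : Type*} {f : Store n → α → Store n} {K : ℕ}
    (hf : ∀ s a, (f s a).steps ≤ s.steps + K) (l : List α) (s : Store n) :
    (l.foldl f s).steps ≤ s.steps + l.length * K := by
  induction l generalizing s with
  | nil => simp
  | cons a l ih =>
    have h1 := ih (f s a)
    have h2 := hf s a
    rw [List.foldl_cons, List.length_cons, Nat.add_mul]
    omega

theorem Cmd.IsBounded.seq {c d : Cmd} (hc : c.IsBounded G M) (hd : d.IsBounded G M) :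
    (c.seq d).IsBounded G M := by
  intro s
  have h1 := hc s
  have h2 := hd (c.run G s)
  simp only [Cmd.run, stepPoly, eval_add, Nat.mul_add]
  omega

theorem Cmd.IsBounded.ite (hM : 1 ≤ M) {t : Test} {c d : Cmd} (hc : c.IsBounded G M)
    (hd : d.IsBounded G M) : (Cmd.ite t c d).IsBounded G M := by
  intro s
  have h1 := hc (s.tick (t.cost n + 1))
  have h2 := hd (s.tick (t.cost n + 1))
  have h3 := Nat.mul_le_mul_right (t.cost n + 1) hM
  simp only [Cmd.run, stepPoly, eval_add, Nat.mul_add, Test.costPoly_eval, eval_one]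
  simp only [Store.tick, Nat.mul_add] at h1 h2 h3 ⊢
  split_ifs <;> omega

theorem Cmd.IsBounded.forVertex (hM : 1 ≤ M) {x : ℕ} {c : Cmd} (hc : c.IsBounded G M) :
    (Cmd.forVertex x c).IsBounded G M := by
  intro s
  have h := foldl_steps_le (K := M * (1 + c.stepPoly.eval n))
    (f := fun s a => c.run G ((s.setVtx x a).tick 1)) (fun s a => by
      have := hc ((s.setVtx x a).tick 1)
      simp only [Store.tick, Store.setVtx, Nat.mul_add] at this ⊢
      omega) (List.finRange n) (s.tick 1)
  rw [List.length_finRange, Nat.mul_left_comm] at h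
  simp only [Cmd.run, stepPoly, eval_add, eval_mul, eval_X, eval_one, Nat.mul_add M 1]
  simp only [Store.tick] at h ⊢
  omega

theorem Cmd.IsBounded.iter (hM : 1 ≤ M) {c : Cmd} (hc : c.IsBounded G M) :
    (Cmd.iter c).IsBounded G M := by
  intro s
  have h := foldl_steps_le (K := M * (1 + c.stepPoly.eval n))
    (f := fun s (_ : Fin n) => c.run G (s.tick 1)) (fun s a => by
      have := hc (s.tick 1)
      simp only [Store.tick, Nat.mul_add] at this ⊢
      omega) (List.finRange n) (s.tick 1)
  rw [List.length_finRange, Nat.mul_left_comm] at h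
  simp only [Cmd.run, stepPoly, eval_add, eval_mul, eval_X, eval_one, Nat.mul_add M 1]
  simp only [Store.tick] at h ⊢
  omega

theorem Cmd.isBounded_of_subsetFree (hM : 1 ≤ M) {c : Cmd} (hc : c.subsetFree = true) :
    c.IsBounded G M := by
  induction c with
  | skip | assign | setOf | pairsOf | print =>
    intro s
    refine le_trans (le_of_eq ?_) (Nat.add_le_add_left (Nat.mul_le_mul_right _ hM) _)
    simp [Cmd.run, stepPoly, Test.costPoly_eval, Store.tick, Store.setVtx, Store.setSet,
      Store.setPairs]
  | seq c d ihc ihd =>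
    simp only [subsetFree, Bool.and_eq_true] at hc
    exact (ihc hc.1).seq (ihd hc.2)
  | ite t c d ihc ihd =>
    simp only [subsetFree, Bool.and_eq_true] at hc
    exact (ihc hc.1).ite hM (ihd hc.2)
  | forVertex y c ih => exact (ih hc).forVertex hM
  | iter c ih => exact (ih hc).iter hM
  | forSubset => simp [subsetFree] at hc

/-! ## Loops over subsets -/

theorem mem_subsetList {B X : Finset (Fin n)} : X ∈ subsetList B ↔ X ⊆ B := by
  simp only [subsetList, List.mem_map, List.mem_sublists]
  constructor
  · rintro ⟨l, hl, rfl⟩ a ha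
    simpa using hl.subset (List.mem_toFinset.mp ha)
  · intro h
    refine ⟨(List.finRange n).filter (fun a => decide (a ∈ X)), ?_, by ext; simp⟩
    have : (List.finRange n).filter (fun a => decide (a ∈ X)) =
        ((List.finRange n).filter (fun a => decide (a ∈ B))).filter (fun a => decide (a ∈ X)) := by
      rw [List.filter_filter]
      congr 1
      ext a
      by_cases ha : a ∈ X <;> simp [ha, @h a]
    rw [this]
    exact List.filter_sublist

theorem length_subsetList (B : Finset (Fin n)) : (subsetList B).length = 2 ^ B.card := by
  have h : ((List.finRange n).filter (fun a => decide (a ∈ B))).toFinset = B := by ext; simp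
  rw [subsetList, List.length_map, List.length_sublists,
    ← List.toFinset_card_of_nodup ((List.nodup_finRange n).filter _), h]

/-- The list has as many entries as the power set it enumerates. -/
theorem nodup_subsetList (B : Finset (Fin n)) : (subsetList B).Nodup := by
  have h : (subsetList B).toFinset = B.powerset := by
    ext X
    simp [mem_subsetList]
  have h2 := Multiset.toFinset_card_eq_card_iff_nodup (m := (↑(subsetList B) : Multiset (Finset (Fin n))))
  rw [Multiset.coe_nodup] at h2
  refine h2.mp ?_
  have h3 : (↑(subsetList B) : Multiset (Finset (Fin n))).toFinset = B.powerset := h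
  rw [h3, Finset.card_powerset, Multiset.coe_card, length_subsetList]

/-- The factor `M` is spent on the number of rounds, so the body must be bounded with factor 1. The
bound depends on the store through the size of `B`, hence this is not an `IsBounded` statement. -/
theorem Cmd.run_forSubset_steps_le {A B : ℕ} {c : Cmd} (hc : c.IsBounded G 1) {s : Store n}
    (hM : 2 ^ (s.set B).card ≤ M) :
    ((Cmd.forSubset A B c).run G s).steps ≤
      s.steps + M * (Cmd.forSubset A B c).stepPoly.eval n := by
  have h := foldl_steps_le (K := n + 1 + c.stepPoly.eval n)
    (f := fun s X => c.run G ((s.setSet A X).tick (n + 1))) (fun s a => by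
      have := hc ((s.setSet A a).tick (n + 1))
      simp only [Store.tick, Store.setSet, one_mul] at this ⊢
      omega) (subsetList (s.set B)) (s.tick (n + 1))
  rw [length_subsetList] at h
  have h2 := Nat.mul_le_mul_right (n + 1 + c.stepPoly.eval n) hM
  have h3 := Nat.mul_le_mul_right (n + 1) (le_trans Nat.one_le_two_pow hM)
  simp only [Cmd.run, stepPoly, eval_add, eval_X, eval_one]
  rw [Nat.mul_add M (n + 1)]
  simp only [Store.tick] at h ⊢
  omega

end GraphProgram

/-! ## The mathematics of the algorithm -/

namespace MhFptList

open GraphProgram SimpleGraph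

variable {n : ℕ}

/-- The complement of the subgraph induced by `T`, as a graph on all vertices. -/
def coGraph (G : SimpleGraph (Fin n)) (T : Finset (Fin n)) : SimpleGraph (Fin n) where
  Adj x y := x ∈ T ∧ y ∈ T ∧ x ≠ y ∧ ¬ G.Adj x y
  symm := ⟨fun _ _ h => ⟨h.2.1, h.1, h.2.2.1.symm, fun h' => h.2.2.2 h'.symm⟩⟩
  loopless := ⟨fun _ h => h.2.2.1 rfl⟩

/-- `E` and `O` are the pairs of vertices in `T` joined by walks of even and odd length. -/
structure IsParity (Γ : SimpleGraph (Fin n)) (T : Finset (Fin n))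
    (E O : Finset (Fin n × Fin n)) : Prop where
  even : ∀ x y, (x, y) ∈ E ↔ x ∈ T ∧ ∃ p : Γ.Walk x y, Even p.length
  odd : ∀ x y, (x, y) ∈ O ↔ x ∈ T ∧ ∃ p : Γ.Walk x y, Odd p.length

/-- The first vertices of the components. -/
def representatives (T : Finset (Fin n)) (E O : Finset (Fin n × Fin n)) : Finset (Fin n) :=
  Finset.univ.filter fun x => x ∈ T ∧ ¬ ∃ y, y < x ∧ ((x, y) ∈ E ∨ (x, y) ∈ O)

/-- The union of the sides selected by `W`. -/
def labeling (R : Finset (Fin n)) (E O : Finset (Fin n × Fin n)) (W : Finset (Fin n)) :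
    Finset (Fin n) :=
  Finset.univ.filter fun x =>
    ∃ y, y ∈ R ∧ ((y ∈ W ∧ (y, x) ∈ E) ∨ (¬ y ∈ W ∧ (y, x) ∈ O))

open Classical in
/-- The union of the shadows of the vertices in `L` with respect to the endpoint of `{i, j}` that
is not in `L`. -/
noncomputable def candidate (G : SimpleGraph (Fin n)) (i j : Fin n) (L : Finset (Fin n)) :
    Finset (Fin n) :=
  Finset.univ.filter fun x => ∃ z ∈ L, x ∈ mShadow G z (if i ∈ L then j else i)

/-- No pair in `T` is an edge that leaves `H`. -/
def Avoids (G : SimpleGraph (Fin n)) (T : Finset (Fin n × Fin n)) (H : Finset (Fin n)) : Prop :=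
  ∀ x ∈ H, ∀ y, y ∉ H → G.Adj x y → (x, y) ∉ T

/-! ### Parity of walks, representatives and labelings. -/

section Parity

variable {G Γ : SimpleGraph (Fin n)} {T : Finset (Fin n)} {E O : Finset (Fin n × Fin n)}

theorem mem_of_walk_coGraph {x y : Fin n} (hx : x ∈ T) (p : (coGraph G T).Walk x y) : y ∈ T := by
  induction p with
  | nil => exact hx
  | cons h p ih => exact ih h.2.1

theorem IsParity.mem_or_mem (h : IsParity Γ T E O) {x y : Fin n} :
    (x, y) ∈ E ∨ (x, y) ∈ O ↔ x ∈ T ∧ Γ.Reachable x y := by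
  rw [h.even, h.odd, ← and_or_left]
  refine and_congr_right fun _ => ⟨?_, fun ⟨p⟩ => ?_⟩
  · rintro (⟨p, -⟩ | ⟨p, -⟩) <;> exact ⟨p⟩
  · exact (Nat.even_or_odd p.length).imp (fun h => ⟨p, h⟩) (fun h => ⟨p, h⟩)

theorem IsParity.mem_representatives (h : IsParity Γ T E O) {x : Fin n} :
    x ∈ representatives T E O ↔ x ∈ T ∧ ∀ y, Γ.Reachable x y → x ≤ y := by
  simp only [representatives, Finset.mem_filter, Finset.mem_univ, true_and, h.mem_or_mem]
  refine and_congr_right fun hx => ?_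
  simp only [hx, true_and, not_exists, not_and']
  exact forall_congr' fun y => by rw [not_lt]

theorem IsParity.eq_of_reachable (h : IsParity Γ T E O) {x y : Fin n}
    (hx : x ∈ representatives T E O) (hy : y ∈ representatives T E O) (hxy : Γ.Reachable x y) :
    x = y :=
  le_antisymm ((h.mem_representatives.mp hx).2 y hxy) ((h.mem_representatives.mp hy).2 x hxy.symm)

theorem IsParity.exists_representative (h : IsParity (coGraph G T) T E O) {x : Fin n}
    (hx : x ∈ T) : ∃ y ∈ representatives T E O, (coGraph G T).Reachable y x := by
  classical
  have hne : (Finset.univ.filter fun y => (coGraph G T).Reachable y x).Nonempty :=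
    ⟨x, by simp⟩
  obtain ⟨y, hy, hmin⟩ := Finset.exists_min_image _ id hne
  simp only [Finset.mem_filter, Finset.mem_univ, true_and, id] at hy hmin
  refine ⟨y, h.mem_representatives.mpr ⟨?_, fun z hz => hmin z (hz.symm.trans hy)⟩, hy⟩
  obtain ⟨p⟩ := hy.symm
  exact mem_of_walk_coGraph hx p

/-- Vertices nonadjacent in `G` share a component of the complement. This is the source of the bound
`2 ^ ω`. -/
theorem IsParity.isClique_representatives (h : IsParity (coGraph G T) T E O) :
    G.IsClique (representatives T E O : Set (Fin n)) := by
  intro x hx y hy hxy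
  by_contra hadj
  have hx' := (h.mem_representatives.mp hx).1
  have hy' := (h.mem_representatives.mp hy).1
  exact hxy (h.eq_of_reachable hx hy (Adj.reachable (G := coGraph G T) ⟨hx', hy', hxy, hadj⟩))

theorem IsParity.labeling_subset (h : IsParity (coGraph G T) T E O)
    (R W : Finset (Fin n)) : labeling R E O W ⊆ T := by
  intro x hx
  simp only [labeling, Finset.mem_filter, Finset.mem_univ, true_and, h.even, h.odd] at hx
  obtain ⟨y, -, ⟨-, hy, p, -⟩ | ⟨-, hy, p, -⟩⟩ := hx <;> exact mem_of_walk_coGraph hy p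

/-- A representative can be put into the labeling only by itself, and not as an odd vertex, since
there is no closed odd walk. Hence different `W` give different labelings. -/
theorem IsParity.labeling_inter (h : IsParity Γ T E O) (hO : ∀ x, (x, x) ∉ O)
    {W : Finset (Fin n)} (hW : W ⊆ representatives T E O) :
    labeling (representatives T E O) E O W ∩ representatives T E O = W := by
  ext x
  simp only [labeling, Finset.mem_inter, Finset.mem_filter, Finset.mem_univ, true_and]
  constructor
  · rintro ⟨⟨y, hy, hyx⟩, hx⟩
    have hr : y = x := h.eq_of_reachable hy hx
      (h.mem_or_mem.mp (hyx.imp (fun h => h.2) (fun h => h.2))).2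
    subst hr
    rcases hyx with hyx | hyx
    · exact hyx.1
    · exact absurd hyx.2 (hO y)
  · intro hx
    refine ⟨⟨x, hW hx, Or.inl ⟨hx, (h.even x x).mpr ⟨?_, Walk.nil, by simp⟩⟩⟩, hW hx⟩
    exact (h.mem_representatives.mp (hW hx)).1

open Classical in
/-- The 2-coloring given by a set. -/
noncomputable def coloringOfSet {H : Set (Fin n)} (hH : ∀ x y, Γ.Adj x y → (x ∈ H ↔ y ∉ H)) :
    Γ.Coloring Bool :=
  Coloring.mk (fun x => decide (x ∈ H)) fun {x y} hxy => by
    have := hH x y hxy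
    by_cases hy : y ∈ H <;> simp_all

open Classical in
theorem even_length_iff_mem {H : Set (Fin n)} (hH : ∀ x y, Γ.Adj x y → (x ∈ H ↔ y ∉ H))
    {x y : Fin n} (p : Γ.Walk x y) : Even p.length ↔ (x ∈ H ↔ y ∈ H) := by
  have h : ∀ x, coloringOfSet hH x = true ↔ x ∈ H := fun x => decide_eq_true_iff
  rw [(coloringOfSet hH).even_length_iff_congr p, h, h]

-- Along a walk of the complement, membership in `H` alternates, so it is fixed on a component by
-- its value at the representative.
open Classical in
theorem IsParity.labeling_eq (h : IsParity (coGraph G T) T E O) {H : Set (Fin n)}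
    (hH : ∀ x y, (coGraph G T).Adj x y → (x ∈ H ↔ y ∉ H)) :
    labeling (representatives T E O) E O ((representatives T E O).filter (· ∈ H)) =
      T.filter (· ∈ H) := by
  ext x
  constructor
  · intro hx
    refine Finset.mem_filter.mpr ⟨h.labeling_subset _ _ hx, ?_⟩
    simp only [labeling, Finset.mem_filter, Finset.mem_univ, true_and, h.even, h.odd] at hx
    obtain ⟨y, hy, ⟨⟨-, hyH⟩, -, p, hp⟩ | ⟨hyH, -, p, hp⟩⟩ := hx
    · rw [even_length_iff_mem hH] at hp
      exact hp.mp hyH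
    · rw [← Nat.not_even_iff_odd, even_length_iff_mem hH] at hp
      tauto
  · intro hx
    obtain ⟨hxT, hxH⟩ := Finset.mem_filter.mp hx
    obtain ⟨y, hy, ⟨p⟩⟩ := h.exists_representative hxT
    have hyT := (h.mem_representatives.mp hy).1
    simp only [labeling, Finset.mem_filter, Finset.mem_univ, true_and, h.even, h.odd]
    refine ⟨y, hy, ?_⟩
    have hp := even_length_iff_mem hH p
    by_cases hyH : y ∈ H
    · exact Or.inl ⟨⟨hy, hyH⟩, hyT, p, hp.mpr (by tauto)⟩
    · exact Or.inr ⟨fun h => hyH h.2, hyT, p, by rw [← Nat.not_even_iff_odd, hp]; tauto⟩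

theorem IsParity.notMem_odd (h : IsParity Γ T E O) {H : Set (Fin n)}
    (hH : ∀ x y, Γ.Adj x y → (x ∈ H ↔ y ∉ H)) (x : Fin n) : (x, x) ∉ O := by
  rw [h.odd]
  rintro ⟨-, p, hp⟩
  rw [← Nat.not_even_iff_odd, even_length_iff_mem hH] at hp
  exact hp Iff.rfl

end Parity

/-! ### Candidates and their traces on the triangle set. -/

section Candidate

variable {G : SimpleGraph (Fin n)} {T L : Finset (Fin n)} {i j : Fin n}

theorem mem_candidate {x : Fin n} :
    x ∈ candidate G i j L ↔ ∃ z ∈ L, x ∈ mShadow G z (if i ∈ L then j else i) := by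
  simp [candidate]

theorem adj_endpoint (hij : G.Adj i j) (hT : (T : Set (Fin n)) = triangleSet G i j)
    {x : Fin n} (hx : x ∈ T) (hxL : x ≠ if i ∈ L then j else i) :
    G.Adj x (if i ∈ L then j else i) := by
  have hx' : x ∈ triangleSet G i j := hT ▸ Finset.mem_coe.mpr hx
  split_ifs at hxL ⊢ with hi
  · exact adj_of_mem_triangleSet hij hx' hxL
  · exact adj_of_mem_triangleSet hij.symm (triangleSet_comm (G := G) i j ▸ hx') hxL

theorem endpoint_notMem (hsep : i ∈ L ↔ j ∉ L) : (if i ∈ L then j else i) ∉ L := by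
  split_ifs with hi
  · exact hsep.mp hi
  · exact hi

/-- All vertices of `T` except the endpoint `w` are neighbours of `w`, and the shadow `z/w` contains
no neighbour of `w` but `z`. It never contains `w`. -/
theorem candidate_inter (hij : G.Adj i j) (hT : (T : Set (Fin n)) = triangleSet G i j)
    (hLT : L ⊆ T) (hsep : i ∈ L ↔ j ∉ L) : candidate G i j L ∩ T = L := by
  have hL : ∀ z ∈ L, G.Adj z (if i ∈ L then j else i) := fun z hz =>
    adj_endpoint hij hT (hLT hz) fun h => endpoint_notMem hsep (h ▸ hz)
  ext x
  rw [Finset.mem_inter, mem_candidate]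
  constructor
  · rintro ⟨⟨z, hz, hxz⟩, hxT⟩
    have hxw : x ≠ if i ∈ L then j else i := by
      rintro rfl
      exact notMem_mShadow_self hxz
    rw [eq_of_mem_mShadow (hL z hz) (adj_endpoint hij hT hxT hxw) hxz]
    exact hz
  · exact fun hx => ⟨⟨x, hx, self_mem_mShadow (hL x hx)⟩, hLT hx⟩

open Classical in
theorem candidate_eq (hG : G.Connected) (hij : G.Adj i j)
    (hT : (T : Set (Fin n)) = triangleSet G i j) {H : Finset (Fin n)}
    (hH : IsMHalfspace G (H : Set (Fin n))) (hsep : i ∈ H ↔ j ∉ H) :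
    candidate G i j (T.filter (· ∈ H)) = H := by
  have hiT : i ∈ T := Finset.mem_coe.mp <| by rw [hT]; exact Or.inr (Or.inl rfl)
  have key : ∀ x, x ∈ H ↔ ∃ z, z ∈ T ∧ z ∈ H ∧ x ∈ mShadow G z (if i ∈ H then j else i) := by
    intro x
    split_ifs with hi
    · have h := Set.ext_iff.mp (hH.eq_iUnion_mShadow hG hij hi (hsep.mp hi)) x
      rw [← hT] at h
      simpa [and_assoc] using h
    · have hj : j ∈ H := by tauto
      have h := Set.ext_iff.mp (hH.eq_iUnion_mShadow hG hij.symm hj hi) x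
      rw [triangleSet_comm, ← hT] at h
      simpa [and_assoc] using h
  ext x
  rw [mem_candidate, key x]
  simp [hiT, and_assoc]

theorem mem_iff_notMem_of_coGraph_adj (hij : G.Adj i j)
    (hT : (T : Set (Fin n)) = triangleSet G i j) {H : Set (Fin n)}
    (hH : IsMHalfspace G H) (hsep : i ∈ H ↔ j ∉ H) {x y : Fin n}
    (hxy : (coGraph G T).Adj x y) : x ∈ H ↔ y ∉ H := by
  have hx : x ∈ triangleSet G i j := hT ▸ Finset.mem_coe.mpr hxy.1
  have hy : y ∈ triangleSet G i j := hT ▸ Finset.mem_coe.mpr hxy.2.1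
  by_cases hi : i ∈ H
  · exact hH.mem_iff_notMem hij hi (hsep.mp hi) hx hy hxy.2.2.1 hxy.2.2.2
  · rw [triangleSet_comm] at hx hy
    exact hH.mem_iff_notMem hij.symm (by tauto) hi hx hy hxy.2.2.1 hxy.2.2.2

end Candidate

end MhFptList

/-! ## The parts of the program -/

namespace MhFptList

open GraphProgram SimpleGraph

variable {n : ℕ} {G : SimpleGraph (Fin n)} [DecidableRel G.Adj]

theorem eval_coEdge {x y : ℕ} {s : Store n} :
    (coEdge x y).eval G s = true ↔ (coGraph G (s.set D)).Adj (s.vtx x) (s.vtx y) := by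
  simp [coEdge, Test.eval, coGraph, and_assoc]

theorem computeTriangle_set (s : Store n) :
    (((computeTriangle.run G s).set D : Finset (Fin n)) : Set (Fin n)) =
      triangleSet G (s.vtx u) (s.vtx v) := by
  ext x
  simp [computeTriangle, Cmd.run, Test.eval, Store.tick, Store.setSet, Store.setVtx, triangleSet]
  tauto

/-- The vertices with a neighbour in `W`. -/
def neighbors (Γ : SimpleGraph (Fin n)) [DecidableRel Γ.Adj] (W : Finset (Fin n)) :
    Finset (Fin n) :=
  Finset.univ.filter fun y => ∃ a, a ∈ W ∧ Γ.Adj a y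

/-- The vertices paired with `x`. -/
def row (E : Finset (Fin n × Fin n)) (x : Fin n) : Finset (Fin n) :=
  Finset.univ.filter fun y => (x, y) ∈ E

/-- `W` together with the vertices joined to `W` by a walk of length two. -/
def twoSteps (Γ : SimpleGraph (Fin n)) [DecidableRel Γ.Adj] (W : Finset (Fin n)) :
    Finset (Fin n) :=
  W ∪ neighbors Γ (neighbors Γ W)

/-! ### Computing the parity relations by iteration. -/

section Parity

variable {T : Finset (Fin n)}

instance : DecidableRel (coGraph G T).Adj := fun x y =>
  inferInstanceAs (Decidable (x ∈ T ∧ y ∈ T ∧ x ≠ y ∧ ¬ G.Adj x y))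

theorem parityRound_row (s : Store n) (i : Fin n) :
    row ((parityRound.run G s).pairs Ev) i =
        twoSteps (coGraph G (s.set D)) (row (s.pairs Ev) i) ∧
      row ((parityRound.run G s).pairs Od) i =
        neighbors (coGraph G (s.set D)) (row (s.pairs Ev) i) := by
  constructor <;> ext j <;>
  simp [parityRound, Cmd.run, Test.eval, Store.tick, Store.setPairs, Store.setVtx, row, twoSteps,
    neighbors, eval_coEdge]

/-- Each round fills `Od` from the old `Ev` before updating `Ev`, so `Od` lags one round behind;
this explains `n - 1`. -/
theorem iter_parityRound {s : Store n} {T : Finset (Fin n)} (hT : s.set D = T) :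
    (∀ i, row (((Cmd.iter parityRound).run G s).pairs Ev) i =
        (twoSteps (coGraph G T))^[n] (row (s.pairs Ev) i)) ∧
      (1 ≤ n → ∀ i, row (((Cmd.iter parityRound).run G s).pairs Od) i =
        neighbors (coGraph G T) ((twoSteps (coGraph G T))^[n - 1] (row (s.pairs Ev) i))) := by
  have h := List.foldl_induction_length (l := List.finRange n) (k := 0) (b := s.tick 1)
    (f := fun s _ => parityRound.run G (s.tick 1))
    (p := fun k s' => s'.set D = T ∧
      (∀ i, row (s'.pairs Ev) i = (twoSteps (coGraph G T))^[k] (row (s.pairs Ev) i)) ∧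
      (1 ≤ k → ∀ i, row (s'.pairs Od) i =
        neighbors (coGraph G T) ((twoSteps (coGraph G T))^[k - 1] (row (s.pairs Ev) i))))
    ⟨hT, fun i => rfl, by omega⟩ (by
      rintro k s' - ⟨h1, h2, -⟩
      have h3 := parityRound_row (G := G) (s'.tick 1)
      have h4 : (s'.tick 1).set D = T := h1
      rw [h4] at h3
      refine ⟨(Cmd.run_set G (by decide) _).trans h1, fun i => ?_, fun _ i => ?_⟩
      · rw [(h3 i).1, Function.iterate_succ_apply', ← h2 i]; rfl
      · rw [(h3 i).2, Nat.add_sub_cancel, ← h2 i]; rfl)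
  rw [List.length_finRange, Nat.zero_add] at h
  exact h.2

/-- The first `n` rounds make the even rows stable; the second `n` ensure that the lagging odd rows
are computed from stable even rows. -/
theorem isParity_of_row {Γ : SimpleGraph (Fin n)} [DecidableRel Γ.Adj]
    {T : Finset (Fin n)} {E O : Finset (Fin n × Fin n)}
    {W : Fin n → Finset (Fin n)} (hW : ∀ i, W i = if i ∈ T then {i} else ∅)
    (hE : ∀ i, row E i = (twoSteps Γ)^[n] ((twoSteps Γ)^[n] (W i)))
    (hO : ∀ i, row O i = neighbors Γ ((twoSteps Γ)^[n - 1] ((twoSteps Γ)^[n] (W i)))) :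
    IsParity Γ T E O := by
  have hinf : ∀ S, S ⊆ twoSteps Γ S := fun S => Finset.subset_union_left
  have hfix : ∀ i, Function.IsFixedPt (twoSteps Γ) ((twoSteps Γ)^[n] (W i)) := fun i =>
    Function.IsFixedPt.iterate_of_le_card hinf _ (by simp)
  have hE' : ∀ i, row E i = (twoSteps Γ)^[n] (W i) := fun i => by
    rw [hE, ((hfix i).iterate n).eq]
  have hO' : ∀ i, row O i = neighbors Γ (row E i) := fun i => by
    rw [hO, ((hfix i).iterate (n - 1)).eq, hE']
  have hmem : ∀ (P : Finset (Fin n × Fin n)) x y, (x, y) ∈ P ↔ y ∈ row P x := by simp [row]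
  have hEO : ∀ i a b, Γ.Adj a b → a ∈ row E i → b ∈ row O i := by
    intro i a b hab ha
    rw [hO']
    simp only [neighbors, Finset.mem_filter, Finset.mem_univ, true_and]
    exact ⟨a, ha, hab⟩
  have hOE : ∀ i a b, Γ.Adj a b → a ∈ row O i → b ∈ row E i := by
    intro i a b hab ha
    rw [hO'] at ha
    rw [hE', ← (hfix i).eq, ← hE']
    refine Finset.mem_union_right _ ?_
    rw [neighbors, Finset.mem_filter]
    exact ⟨Finset.mem_univ b, a, ha, hab⟩
  have hsound : ∀ i (k : ℕ), ∀ x ∈ (twoSteps Γ)^[k] (W i),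
      i ∈ T ∧ ∃ p : Γ.Walk i x, Even p.length := by
    intro i k
    induction k with
    | zero =>
      intro x hx
      rw [Function.iterate_zero_apply, hW] at hx
      split_ifs at hx with hi
      · rw [Finset.mem_singleton] at hx
        subst hx
        exact ⟨hi, Walk.nil, by simp⟩
      · simp at hx
    | succ k ih =>
      intro x hx
      rw [Function.iterate_succ_apply'] at hx
      rcases Finset.mem_union.mp hx with hx | hx
      · exact ih x hx
      · simp only [neighbors, Finset.mem_filter, Finset.mem_univ, true_and] at hx
        obtain ⟨a, ⟨b, hb, hba⟩, hax⟩ := hx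
        obtain ⟨hi, p, hp⟩ := ih b hb
        exact ⟨hi, (p.concat hba).concat hax, by simpa [Nat.even_add_one] using hp⟩
  have hself : ∀ i ∈ T, i ∈ row E i := by
    intro i hi
    rw [hE']
    have : ∀ k : ℕ, W i ⊆ (twoSteps Γ)^[k] (W i) := by
      intro k
      induction k with
      | zero => exact subset_rfl
      | succ k ih =>
        rw [Function.iterate_succ_apply']
        exact ih.trans (hinf _)
    exact this n (by simp [hW, hi])
  have hwalk : ∀ i (a b : Fin n) (p : Γ.Walk a b),
      (a ∈ row E i → (Even p.length → b ∈ row E i) ∧ (Odd p.length → b ∈ row O i)) ∧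
      (a ∈ row O i → (Even p.length → b ∈ row O i) ∧ (Odd p.length → b ∈ row E i)) := by
    intro i a b p
    induction p with
    | nil => simp
    | cons h p ih =>
      simp only [Walk.length_cons, Nat.even_add_one, Nat.odd_add_one, Nat.not_even_iff_odd,
        Nat.not_odd_iff_even]
      exact ⟨fun ha => (ih.2 (hEO i _ _ h ha)).symm, fun ha => (ih.1 (hOE i _ _ h ha)).symm⟩
  constructor
  · intro x y
    rw [hmem]
    refine ⟨fun hy => hsound x n y (hE' x ▸ hy), ?_⟩
    rintro ⟨hx, p, hp⟩
    exact ((hwalk x x y p).1 (hself x hx)).1 hp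
  · intro x y
    rw [hmem]
    constructor
    · intro hy
      rw [hO', hE'] at hy
      simp only [neighbors, Finset.mem_filter, Finset.mem_univ, true_and] at hy
      obtain ⟨a, ha, hay⟩ := hy
      obtain ⟨hx, p, hp⟩ := hsound x n a ha
      exact ⟨hx, p.concat hay, by simpa [Nat.odd_add_one] using hp⟩
    · rintro ⟨hx, p, hp⟩
      exact ((hwalk x x y p).1 (hself x hx)).2 hp

theorem isParity_computeParity (hn : 1 ≤ n) (s : Store n) :
    IsParity (coGraph G (s.set D)) (s.set D) ((computeParity.run G s).pairs Ev)
      ((computeParity.run G s).pairs Od) := by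
  set s1 := (Cmd.pairsOf Ev x y (.and (.mem x D) (.eq x y))).run G s with hs1
  set s2 := (Cmd.iter parityRound).run G s1 with hs2
  have h1 : s1.set D = s.set D := Cmd.run_set G (by decide) s
  have h2 : s2.set D = s.set D := (Cmd.run_set G (by decide) s1).trans h1
  have hrow : ∀ i, row (s1.pairs Ev) i = if i ∈ s.set D then {i} else ∅ := by
    intro i
    ext j
    have : j ∈ row (s1.pairs Ev) i ↔ i ∈ s.set D ∧ i = j := by
      simp [hs1, row, Cmd.run, Test.eval, Store.tick, Store.setPairs, Store.setVtx]
    rw [this]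
    by_cases hi : i ∈ s.set D <;> simp [hi, eq_comm]
  have h3 := iter_parityRound (G := G) h1
  have h4 := iter_parityRound (G := G) h2
  refine isParity_of_row hrow ?_ ?_
  · intro i
    rw [← h3.1 i]
    exact h4.1 i
  · intro i
    rw [← h3.1 i]
    exact h4.2 hn i

end Parity

theorem eval_isBipartiteTest {s : Store n} :
    isBipartiteTest.eval G s = true ↔ ∀ i, (i, i) ∉ s.pairs Od := by
  simp [isBipartiteTest, Test.eval, Store.setVtx]

theorem chooseRepresentatives_set (s : Store n) :
    (chooseRepresentatives.run G s).set R =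
      representatives (s.set D) (s.pairs Ev) (s.pairs Od) := by
  ext i
  simp [chooseRepresentatives, representatives, Cmd.run, Test.eval, Store.tick, Store.setSet,
    Store.setVtx]

theorem computeLabeling_set (s : Store n) :
    (computeLabeling.run G s).set S =
      labeling (s.set R) (s.pairs Ev) (s.pairs Od) (s.set U) := by
  ext i
  simp [computeLabeling, labeling, Cmd.run, Test.eval, Store.tick, Store.setSet, Store.setVtx]

theorem eval_separatesTest {s : Store n} :
    separatesTest.eval G s = true ↔ (s.vtx u ∈ s.set S ↔ s.vtx v ∉ s.set S) := by
  simp [separatesTest, Test.eval]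
  tauto

theorem chooseEndpoint_vtx (s : Store n) :
    (chooseEndpoint.run G s).vtx w = if s.vtx u ∈ s.set S then s.vtx v else s.vtx u := by
  simp only [chooseEndpoint, Cmd.run, Test.eval, decide_eq_true_eq]
  split_ifs <;> simp [Store.tick, Store.setVtx]

/-- One round of the computation of a shadow with respect to `j`. -/
def extendShadow (G : SimpleGraph (Fin n)) [DecidableRel G.Adj] (j : Fin n) (W : Finset (Fin n)) :
    Finset (Fin n) :=
  W ∪ Finset.univ.filter fun x => (x ≠ j ∧ ¬ G.Adj x j) ∧ ∃ y, y ∈ W ∧ G.Adj y x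

theorem mem_iterate_extendShadow {i j k : Fin n} (hij : G.Adj i j) :
    k ∈ (extendShadow G j)^[n] {i} ↔ k ∈ mShadow G i j := by
  rw [mem_mShadow_iff hij]
  have hinf : ∀ W, W ⊆ extendShadow G j W := fun W => Finset.subset_union_left
  constructor
  · have hsound : ∀ (m : ℕ), ∀ x ∈ (extendShadow G j)^[m] {i},
        ∃ p : G.Walk i x, ∀ a ∈ p.support, a = i ∨ (a ≠ j ∧ ¬ G.Adj a j) := by
      intro m
      induction m with
      | zero =>
        intro x hx
        obtain rfl := Finset.mem_singleton.mp hx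
        exact ⟨Walk.nil, by simp⟩
      | succ m ih =>
        intro x hx
        rw [Function.iterate_succ_apply'] at hx
        rcases Finset.mem_union.mp hx with hx | hx
        · exact ih x hx
        · obtain ⟨-, hxj, y, hy, hyx⟩ := Finset.mem_filter.mp hx
          obtain ⟨p, hp⟩ := ih y hy
          refine ⟨p.concat hyx, fun a ha => ?_⟩
          rw [Walk.support_concat, List.mem_append, List.mem_singleton] at ha
          rcases ha with ha | rfl
          · exact hp a ha
          · exact Or.inr hxj
    exact hsound n k
  · have hfix : Function.IsFixedPt (extendShadow G j) ((extendShadow G j)^[n] {i}) :=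
      Function.IsFixedPt.iterate_of_le_card hinf _ (by simp)
    have hself : ∀ m : ℕ, i ∈ (extendShadow G j)^[m] {i} := by
      intro m
      induction m with
      | zero => exact Finset.mem_singleton_self i
      | succ m ih =>
        rw [Function.iterate_succ_apply']
        exact hinf _ ih
    have hwalk : ∀ (a b : Fin n) (p : G.Walk a b),
        (∀ c ∈ p.support, c = i ∨ (c ≠ j ∧ ¬ G.Adj c j)) →
        a ∈ (extendShadow G j)^[n] {i} → b ∈ (extendShadow G j)^[n] {i} := by
      intro a b p
      induction p with
      | nil => exact fun _ h => h
      | @cons a c b h p ih =>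
        intro hp ha
        refine ih (fun d hd => hp d (List.mem_cons_of_mem _ hd)) ?_
        rcases hp c (by simp) with rfl | hc
        · exact hself n
        · rw [← hfix.eq]
          refine Finset.mem_union_right _ (Finset.mem_filter.mpr ⟨Finset.mem_univ c, hc, a, ha, h⟩)
    rintro ⟨p, hp⟩
    exact hwalk i k p hp (hself n)

theorem mem_computeShadow {s : Store n} (hzw : G.Adj (s.vtx z) (s.vtx w)) {k : Fin n} :
    k ∈ (computeShadow.run G s).set Y ↔ k ∈ mShadow G (s.vtx z) (s.vtx w) := by
  rw [← mem_iterate_extendShadow hzw]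
  set s1 := (Cmd.setOf Y x (.eq x z)).run G s with hs1
  have h0 : s1.set Y = {s.vtx z} := by
    ext a
    simp [hs1, Cmd.run, Test.eval, Store.tick, Store.setSet, Store.setVtx]
  have h := List.foldl_induction_length (l := List.finRange n) (k := 0) (b := s1.tick 1)
    (f := fun s _ => (Cmd.setOf Y x (.or (.mem x Y)
      (.and (.and (.not (.eq x w)) (.not (.adj x w)))
        (.ex y (.and (.mem y Y) (.adj y x)))))).run G (s.tick 1))
    (p := fun m s' => s'.vtx w = s.vtx w ∧
      s'.set Y = (extendShadow G (s.vtx w))^[m] {s.vtx z})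
    ⟨rfl, h0⟩ (by
      rintro m s' - ⟨h1, h2⟩
      refine ⟨h1, ?_⟩
      rw [Function.iterate_succ_apply', ← h2, ← h1]
      ext a
      simp [Cmd.run, Test.eval, Store.tick, Store.setSet, Store.setVtx, extendShadow])
  rw [List.length_finRange, Nat.zero_add] at h
  rw [← h.2]
  rfl

theorem mem_computeUnionOfShadows {s : Store n}
    (hw : ∀ i ∈ s.set S, G.Adj i (s.vtx w)) {k : Fin n} :
    k ∈ (computeUnionOfShadows.run G s).set X ↔ ∃ i ∈ s.set S, k ∈ mShadow G i (s.vtx w) := by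
  set s1 := (Cmd.setOf X x (.not (.eq x x))).run G s with hs1
  have h0 : s1.set X = ∅ := by
    ext a
    simp [hs1, Cmd.run, Test.eval, Store.tick, Store.setSet]
  have hrun : (computeUnionOfShadows.run G s).set X =
    ((List.finRange n).foldl (fun s a => (Cmd.ite (.mem z S)
      (.seq computeShadow (.setOf X x (.or (.mem x X) (.mem x Y)))) .skip).run G
        ((s.setVtx z a).tick 1)) (s1.tick 1)).set X := rfl
  rw [hrun]
  have key : ∀ (l : List (Fin n)) (s' : Store n), s'.vtx w = s.vtx w → s'.set S = s.set S →
      (k ∈ (l.foldl (fun s a => (Cmd.ite (.mem z S)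
      (.seq computeShadow (.setOf X x (.or (.mem x X) (.mem x Y)))) .skip).run G
        ((s.setVtx z a).tick 1)) s').set X ↔
        k ∈ s'.set X ∨ ∃ i ∈ l, i ∈ s.set S ∧ k ∈ mShadow G i (s.vtx w)) := by
    intro l
    induction l with
    | nil => simp
    | cons a l ih =>
      intro s' h1 h2
      rw [List.foldl_cons]
      set t := (s'.setVtx z a).tick 1 with ht
      have htz : t.vtx z = a := by simp [ht, Store.tick, Store.setVtx]
      have htw : t.vtx w = s.vtx w := by simpa [ht, Store.tick, Store.setVtx] using h1
      have htS : t.set S = s.set S := h2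
      rw [ih (Cmd.run G _ t) ((Cmd.run_vtx G (by decide) t).trans htw)
        ((Cmd.run_set G (by decide) t).trans htS)]
      by_cases ha : a ∈ s.set S
      · have hsh := mem_computeShadow (G := G) (s := t.tick 2) (k := k)
          (by change G.Adj (t.vtx z) (t.vtx w); rw [htz, htw]; exact hw a ha)
        have hX : (computeShadow.run G (t.tick 2)).set X = s'.set X :=
          Cmd.run_set G (by decide) _
        have : (t.tick 2).vtx z = a := htz
        rw [this] at hsh
        have : (t.tick 2).vtx w = s.vtx w := htw
        rw [this] at hsh
        have htrue : (Test.mem z S).eval G t = true := by simp [Test.eval, htz, htS, ha]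
        rw [Cmd.run, if_pos htrue]
        simp only [Cmd.run, Test.cost]
        simp [Test.eval, Store.tick, Store.setSet, Store.setVtx, ha] at hsh hX ⊢
        rw [hsh, hX]
        tauto
      · have hfalse : ¬ (Test.mem z S).eval G t = true := by simp [Test.eval, htz, htS, ha]
        rw [Cmd.run, if_neg hfalse]
        have : (Cmd.skip.run G (t.tick ((Test.mem z S).cost n + 1))).set X = s'.set X := rfl
        rw [this]
        simp [ha]
  rw [key _ (s1.tick 1) rfl rfl]
  have : (s1.tick 1).set X = ∅ := h0
  rw [this]
  simp

theorem eval_isHalfspaceTest (hG : G.Connected) {s : Store n} :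
    isHalfspaceTest.eval G s = true ↔ IsMHalfspace G (s.set X : Set (Fin n)) := by
  rw [isMHalfspace_iff hG]
  simp [isHalfspaceTest, Test.eval, Store.setVtx, HasCliqueBorder]
  grind

theorem eval_avoidsTreatedEdges {s : Store n} :
    avoidsTreatedEdges.eval G s = true ↔ Avoids G (s.pairs B) (s.set X) := by
  simp [avoidsTreatedEdges, Test.eval, Store.setVtx, Avoids]
  grind

theorem mem_markEdge {s : Store n} {i j : Fin n} :
    (i, j) ∈ (markEdge.run G s).pairs B ↔ (i, j) ∈ s.pairs B ∨
      (i = s.vtx u ∧ j = s.vtx v) ∨ (i = s.vtx v ∧ j = s.vtx u) := by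
  simp [markEdge, Cmd.run, Test.eval, Store.tick, Store.setPairs, Store.setVtx]

end MhFptList

/-! ## The correctness of the algorithm -/

namespace MhFptList

open GraphProgram SimpleGraph

variable {n : ℕ} {G : SimpleGraph (Fin n)}

/-- The halfspaces printed so far are `∅`, `V`, and those that cut a treated edge, once each. -/
def Invariant (G : SimpleGraph (Fin n)) (s : Store n) : Prop :=
  s.out.Nodup ∧ ∀ H : Finset (Fin n), H ∈ s.out ↔ IsMHalfspace G (H : Set (Fin n)) ∧
    (H = ∅ ∨ H = Finset.univ ∨ ¬ Avoids G (s.pairs B) H)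

/-- The edge `{i, j}` has been treated. -/
def Treated (G : SimpleGraph (Fin n)) (i j : Fin n) (s : Store n) : Prop :=
  ∀ H : Finset (Fin n), IsMHalfspace G (H : Set (Fin n)) → (i ∈ H ↔ j ∉ H) →
    ¬ Avoids G (s.pairs B) H

/-- No halfspace that cuts a treated edge of `s` avoids the treated edges of `s'`. -/
def Later (G : SimpleGraph (Fin n)) (s s' : Store n) : Prop :=
  ∀ H : Finset (Fin n), IsMHalfspace G (H : Set (Fin n)) → ¬ Avoids G (s.pairs B) H →
    ¬ Avoids G (s'.pairs B) H

theorem Treated.mono {i j : Fin n} {s s' : Store n} (h : Treated G i j s) (h' : Later G s s') :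
    Treated G i j s' :=
  fun H hH hij => h' H hH (h H hH hij)

theorem Invariant.mem_out_iff (hG : G.Connected) {s : Store n} (hs : Invariant G s)
    (ht : ∀ i j, G.Adj i j → i < j → Treated G i j s) (H : Finset (Fin n)) :
    H ∈ s.out ↔ IsMHalfspace G (H : Set (Fin n)) := by
  rw [hs.2]
  refine and_iff_left_of_imp fun hH => ?_
  by_contra! hne
  obtain ⟨i, hi⟩ := hne.1
  obtain ⟨j, hj⟩ : ∃ j, j ∉ H := by
    by_contra! h
    exact hne.2.1 (Finset.eq_univ_iff_forall.mpr h)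
  obtain ⟨p⟩ := hG.preconnected j i
  obtain ⟨a, -, ha, b, hb, hab⟩ :=
    p.exists_adj_of_notMem_of_mem (X := (H : Set (Fin n))) hj hi
  rw [Finset.mem_coe] at ha hb
  rcases lt_or_gt_of_ne hab.ne with h | h
  · exact ht a b hab h H hH (by tauto) hne.2.2
  · exact ht b a hab.symm h H hH (by tauto) hne.2.2

variable [DecidableRel G.Adj]

/-- The candidate for the labeling `L` of the triangle set of `{i, j}` is printed. -/
def Prints (G : SimpleGraph (Fin n)) (i j : Fin n) (P : Finset (Fin n × Fin n))
    (L : Finset (Fin n)) : Prop :=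
  (i ∈ L ↔ j ∉ L) ∧ IsMHalfspace G (candidate G i j L : Set (Fin n)) ∧
    Avoids G P (candidate G i j L)

open Classical in
theorem trySubset_out (hG : G.Connected) {s : Store n} (hij : G.Adj (s.vtx u) (s.vtx v))
    (hT : (s.set D : Set (Fin n)) = triangleSet G (s.vtx u) (s.vtx v))
    (hP : IsParity (coGraph G (s.set D)) (s.set D) (s.pairs Ev) (s.pairs Od))
    {L : Finset (Fin n)}
    (hL : labeling (s.set R) (s.pairs Ev) (s.pairs Od) (s.set U) = L) :
    (trySubset.run G s).out = s.out ++
      if Prints G (s.vtx u) (s.vtx v) (s.pairs B) L then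
        [candidate G (s.vtx u) (s.vtx v) L] else [] := by
  set s1 := computeLabeling.run G s with hs1
  have hLT : L ⊆ s.set D := hL ▸ hP.labeling_subset _ _
  have h1S : s1.set S = L := (computeLabeling_set s).trans hL
  have h1u : s1.vtx u = s.vtx u := Cmd.run_vtx G (by decide) s
  have h1v : s1.vtx v = s.vtx v := Cmd.run_vtx G (by decide) s
  have hsepT : separatesTest.eval G s1 = true ↔ (s.vtx u ∈ L ↔ s.vtx v ∉ L) := by
    rw [eval_separatesTest, h1S, h1u, h1v]
  rw [trySubset, Cmd.run, Cmd.run, ← hs1]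
  by_cases hsep : s.vtx u ∈ L ↔ s.vtx v ∉ L
  · rw [if_pos (hsepT.mpr hsep)]
    set s2 := s1.tick (separatesTest.cost n + 1) with hs2
    set s3 := chooseEndpoint.run G s2 with hs3
    set s4 := computeUnionOfShadows.run G s3 with hs4
    have h3w : s3.vtx w = if s.vtx u ∈ L then s.vtx v else s.vtx u := by
      rw [hs3, chooseEndpoint_vtx]
      change (if s1.vtx u ∈ s1.set S then s1.vtx v else s1.vtx u) = _
      rw [h1S, h1u, h1v]
    have h3S : s3.set S = L := (Cmd.run_set G (by decide) s2).trans h1S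
    have h4X : s4.set X = candidate G (s.vtx u) (s.vtx v) L := by
      ext k
      rw [hs4, mem_computeUnionOfShadows, mem_candidate, h3S, h3w]
      rw [h3S, h3w]
      exact fun a ha => adj_endpoint hij hT (hLT ha) fun h => endpoint_notMem hsep (h ▸ ha)
    have h4B : s4.pairs B = s.pairs B :=
      (Cmd.run_pairs G (by decide) s3).trans <| (Cmd.run_pairs G (by decide) s2).trans <|
        Cmd.run_pairs G (c := computeLabeling) (by decide) s
    have h4out : s4.out = s.out :=
      (Cmd.run_out G (by decide) s3).trans <| (Cmd.run_out G (by decide) s2).trans <|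
        Cmd.run_out G (c := computeLabeling) (by decide) s
    have htest : (Test.and isHalfspaceTest avoidsTreatedEdges).eval G s4 = true ↔
        Prints G (s.vtx u) (s.vtx v) (s.pairs B) L := by
      rw [Test.eval, Bool.and_eq_true, eval_isHalfspaceTest hG, eval_avoidsTreatedEdges, h4X, h4B]
      exact ⟨fun h => ⟨hsep, h⟩, fun h => h.2⟩
    change ((Cmd.ite (.and isHalfspaceTest avoidsTreatedEdges) (.print X) .skip).run G s4).out = _
    rw [Cmd.run]
    by_cases hpr : Prints G (s.vtx u) (s.vtx v) (s.pairs B) L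
    · rw [if_pos (htest.mpr hpr), if_pos hpr, ← h4out, ← h4X]
      rfl
    · rw [if_neg fun h => hpr (htest.mp h), if_neg hpr, ← h4out, List.append_nil]
      rfl
  · rw [if_neg fun h => hsep (hsepT.mp h), if_neg fun h => hsep h.1, List.append_nil]
    exact Cmd.run_out G (by decide) s

open Classical in
theorem forSubset_out (hG : G.Connected) {s : Store n} (hij : G.Adj (s.vtx u) (s.vtx v))
    (hT : (s.set D : Set (Fin n)) = triangleSet G (s.vtx u) (s.vtx v))
    (hP : IsParity (coGraph G (s.set D)) (s.set D) (s.pairs Ev) (s.pairs Od)) :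
    ((Cmd.forSubset U R trySubset).run G s).out = s.out ++
      ((subsetList (s.set R)).filter fun W => Prints G (s.vtx u) (s.vtx v) (s.pairs B)
        (labeling (s.set R) (s.pairs Ev) (s.pairs Od) W)).map fun W =>
          candidate G (s.vtx u) (s.vtx v) (labeling (s.set R) (s.pairs Ev) (s.pairs Od) W) := by
  have key : ∀ (l : List (Finset (Fin n))) (s' : Store n), s'.vtx u = s.vtx u →
      s'.vtx v = s.vtx v → s'.set D = s.set D → s'.set R = s.set R → s'.pairs = s.pairs →
      (l.foldl (fun s W => trySubset.run G ((s.setSet U W).tick (n + 1))) s').out = s'.out ++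
      (l.filter fun W => Prints G (s.vtx u) (s.vtx v) (s.pairs B)
        (labeling (s.set R) (s.pairs Ev) (s.pairs Od) W)).map fun W =>
          candidate G (s.vtx u) (s.vtx v) (labeling (s.set R) (s.pairs Ev) (s.pairs Od) W) := by
    intro l
    induction l with
    | nil => simp
    | cons W l ih =>
      intro s' hu hv hD hR hpairs
      set t := (s'.setSet U W).tick (n + 1) with ht
      have htu : t.vtx u = s.vtx u := hu
      have htv : t.vtx v = s.vtx v := hv
      have htD : t.set D = s.set D := by simpa [ht, Store.tick, Store.setSet] using hD
      have htR : t.set R = s.set R := by simpa [ht, Store.tick, Store.setSet] using hR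
      have htU : t.set U = W := by simp [ht, Store.tick, Store.setSet]
      have htp : t.pairs = s.pairs := hpairs
      have hout := trySubset_out (G := G) hG (s := t)
        (L := labeling (s.set R) (s.pairs Ev) (s.pairs Od) W) (by rwa [htu, htv])
        (by rwa [htu, htv, htD]) (by rwa [htD, htp]) (by rw [htR, htp, htU])
      rw [List.foldl_cons, ih (trySubset.run G t) ((Cmd.run_vtx G (by decide) t).trans htu)
        ((Cmd.run_vtx G (by decide) t).trans htv) ((Cmd.run_set G (by decide) t).trans htD)
        ((Cmd.run_set G (by decide) t).trans htR)
        ((funext fun P => Cmd.run_pairs G (by simp [trySubset, computeLabeling, chooseEndpoint,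
          computeUnionOfShadows, computeShadow, Cmd.block, Cmd.pairWrites]) t).trans htp),
        hout, htu, htv, htp, List.append_assoc, List.filter_cons]
      have : t.out = s'.out := rfl
      rw [this]
      congr 1
      by_cases hpr : Prints G (s.vtx u) (s.vtx v) (s.pairs B)
        (labeling (s.set R) (s.pairs Ev) (s.pairs Od) W) <;> simp [hpr]
  exact key _ (s.tick (n + 1)) rfl rfl rfl rfl rfl

theorem avoids_markEdge {s : Store n} (hij : G.Adj (s.vtx u) (s.vtx v)) {H : Finset (Fin n)} :
    Avoids G ((markEdge.run G s).pairs B) H ↔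
      Avoids G (s.pairs B) H ∧ ¬ (s.vtx u ∈ H ↔ s.vtx v ∉ H) := by
  unfold Avoids
  simp only [mem_markEdge]
  have := hij.symm
  grind

theorem treatEdge_spec (hG : G.Connected) {s : Store n} (hij : G.Adj (s.vtx u) (s.vtx v)) :
    (∃ l : List (Finset (Fin n)), (treatEdge.run G s).out = s.out ++ l ∧ l.Nodup ∧
      ∀ H : Finset (Fin n), H ∈ l ↔ IsMHalfspace G (H : Set (Fin n)) ∧
        (s.vtx u ∈ H ↔ s.vtx v ∉ H) ∧ Avoids G (s.pairs B) H) ∧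
    ∀ H : Finset (Fin n), IsMHalfspace G (H : Set (Fin n)) →
      (Avoids G ((treatEdge.run G s).pairs B) H ↔
        Avoids G (s.pairs B) H ∧ ¬ (s.vtx u ∈ H ↔ s.vtx v ∉ H)) := by
  classical
  set s1 := computeTriangle.run G s with hs1
  set s2 := computeParity.run G s1 with hs2
  have h2D : s2.set D = s1.set D := Cmd.run_set G (by decide) s1
  have h2u : s2.vtx u = s.vtx u := Cmd.run_vtx G (by decide) s1
  have h2v : s2.vtx v = s.vtx v := Cmd.run_vtx G (by decide) s1
  have h2B : s2.pairs B = s.pairs B := Cmd.run_pairs G (by decide) s1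
  have h2out : s2.out = s.out := Cmd.run_out G (by decide) s1
  have hT : (s2.set D : Set (Fin n)) = triangleSet G (s.vtx u) (s.vtx v) := by
    rw [h2D, hs1]
    exact computeTriangle_set s
  have hP : IsParity (coGraph G (s2.set D)) (s2.set D) (s2.pairs Ev) (s2.pairs Od) := by
    rw [h2D]
    exact isParity_computeParity (s.vtx u).pos s1
  have hrun : treatEdge.run G s = ((Cmd.ite isBipartiteTest
      (.block [chooseRepresentatives, .forSubset U R trySubset, markEdge]) .skip).run G
        s2).tick 1 := rfl
  rw [Cmd.run] at hrun
  by_cases hbip : isBipartiteTest.eval G s2 = true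
  · rw [if_pos hbip] at hrun
    set s3 := s2.tick (isBipartiteTest.cost n + 1) with hs3
    set s4 := chooseRepresentatives.run G s3 with hs4
    set s5 := (Cmd.forSubset U R trySubset).run G s4 with hs5
    have hrun : treatEdge.run G s = ((markEdge.run G s5).tick 1).tick 1 := hrun
    have h4D : s4.set D = s2.set D := Cmd.run_set G (by decide) s3
    have h4u : s4.vtx u = s.vtx u := (Cmd.run_vtx G (by decide) s3).trans h2u
    have h4v : s4.vtx v = s.vtx v := (Cmd.run_vtx G (by decide) s3).trans h2v
    have h4p : s4.pairs = s2.pairs := rfl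
    have h4out : s4.out = s.out := h2out
    have h4R : s4.set R = representatives (s2.set D) (s2.pairs Ev) (s2.pairs Od) :=
      chooseRepresentatives_set s3
    have h5u : s5.vtx u = s.vtx u := (Cmd.run_vtx G (by decide) s4).trans h4u
    have h5v : s5.vtx v = s.vtx v := (Cmd.run_vtx G (by decide) s4).trans h4v
    have h5B : s5.pairs B = s.pairs B := (Cmd.run_pairs G (by decide) s4).trans h2B
    have h5out := forSubset_out (G := G) hG (s := s4) (by rwa [h4u, h4v])
      (by rwa [h4u, h4v, h4D]) (by rwa [h4D, h4p])
    rw [← hs5, h4u, h4v, h4p, h4R, h4out, h2B] at h5out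
    have hout : (treatEdge.run G s).out = s5.out := by
      rw [hrun]
      exact Cmd.run_out G (by decide) s5
    rw [eval_isBipartiteTest] at hbip
    constructor
    · refine ⟨_, hout.trans h5out, ?_, ?_⟩
      · refine List.Nodup.map_on ?_ ((nodup_subsetList _).filter _)
        intro W hW W' hW' heq
        simp only [List.mem_filter, decide_eq_true_eq, mem_subsetList] at hW hW'
        have h1 := candidate_inter hij hT (hP.labeling_subset _ W) hW.2.1
        have h2 := candidate_inter hij hT (hP.labeling_subset _ W') hW'.2.1
        rw [heq, h2] at h1
        rw [← hP.labeling_inter hbip hW.1, ← h1, hP.labeling_inter hbip hW'.1]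
      · intro H
        simp only [List.mem_map, List.mem_filter, decide_eq_true_eq, mem_subsetList]
        constructor
        · rintro ⟨W, ⟨hW, hsep, hhalf, hav⟩, rfl⟩
          refine ⟨hhalf, ?_, hav⟩
          have h1 := candidate_inter hij hT (hP.labeling_subset _ W) hsep
          have hiT : s.vtx u ∈ s2.set D :=
            Finset.mem_coe.mp <| by rw [hT]; exact Or.inr (Or.inl rfl)
          have hjT : s.vtx v ∈ s2.set D :=
            Finset.mem_coe.mp <| by rw [hT]; exact Or.inr (Or.inr rfl)
          rw [← h1] at hsep
          simpa [hiT, hjT] using hsep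
        · rintro ⟨hhalf, hsep, hav⟩
          have hlab := hP.labeling_eq (H := (H : Set (Fin n))) fun a b hab =>
            mem_iff_notMem_of_coGraph_adj hij hT hhalf hsep hab
          have hcand := candidate_eq hG hij hT hhalf hsep
          have hiT : s.vtx u ∈ s2.set D :=
            Finset.mem_coe.mp <| by rw [hT]; exact Or.inr (Or.inl rfl)
          have hjT : s.vtx v ∈ s2.set D :=
            Finset.mem_coe.mp <| by rw [hT]; exact Or.inr (Or.inr rfl)
          simp only [Finset.mem_coe] at hlab
          refine ⟨_, ⟨Finset.filter_subset (· ∈ H) _, ?_⟩, ?_⟩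
          · rw [hlab, Prints, hcand]
            exact ⟨by simpa [hiT, hjT] using hsep, hhalf, hav⟩
          · rw [hlab, hcand]
    · intro H _
      have h := avoids_markEdge (G := G) (s := s5) (H := H) (by rwa [h5u, h5v])
      rw [h5u, h5v, h5B] at h
      rw [hrun]
      exact h
  · rw [if_neg hbip] at hrun
    have hsep : ∀ H : Finset (Fin n), IsMHalfspace G (H : Set (Fin n)) →
        ¬ (s.vtx u ∈ H ↔ s.vtx v ∉ H) := by
      intro H hhalf hsep
      apply hbip
      rw [eval_isBipartiteTest]
      exact hP.notMem_odd (H := (H : Set (Fin n))) fun a b hab =>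
        mem_iff_notMem_of_coGraph_adj hij hT hhalf hsep hab
    constructor
    · refine ⟨[], ?_, List.nodup_nil, fun H => ⟨by simp, fun h => absurd h.2.1 (hsep H h.1)⟩⟩
      rw [hrun, List.append_nil]
      exact h2out
    · intro H hhalf
      rw [hrun]
      change Avoids G (s2.pairs B) H ↔ _
      rw [h2B]
      exact ⟨fun h => ⟨h, hsep H hhalf⟩, fun h => h.1⟩

theorem Invariant.treatEdge (hG : G.Connected) {s : Store n}
    (hij : G.Adj (s.vtx u) (s.vtx v)) (hs : Invariant G s) :
    Invariant G (treatEdge.run G s) := by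
  obtain ⟨⟨l, hl, hnd, hmem⟩, hav⟩ := treatEdge_spec hG hij
  have hne : ∀ H ∈ l, H ≠ ∅ ∧ H ≠ Finset.univ := by
    intro H hH
    have := ((hmem H).mp hH).2.1
    constructor <;> rintro rfl <;> simp at this
  refine ⟨?_, fun H => ?_⟩
  · rw [hl]
    refine List.Nodup.append hs.1 hnd fun H hH hH' => ?_
    have h1 := (hs.2 H).mp hH
    have h2 := (hmem H).mp hH'
    have h3 := hne H hH'
    tauto
  · rw [hl, List.mem_append, hs.2, hmem]
    have := hav H
    tauto

theorem inner_loop (hG : G.Connected) {i : Fin n} {s : Store n} (hi : s.vtx u = i)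
    (hs : Invariant G s) :
    let s' := (Cmd.forVertex v (.ite (.and (.adj u v) (.lt u v)) treatEdge .skip)).run G s
    (Invariant G s' ∧ Later G s s') ∧ ∀ j, G.Adj i j → i < j → Treated G i j s' := by
  intro s'
  have h := List.foldl_induction_done (l := List.finRange n) (b := s.tick 1)
    (f := fun s a => (Cmd.ite (.and (.adj u v) (.lt u v)) treatEdge .skip).run G
      ((s.setVtx v a).tick 1))
    (p := fun t => t.vtx u = i ∧ Invariant G t ∧ Later G s t)
    (done := fun j t => G.Adj i j → i < j → Treated G i j t)
    ⟨hi, hs, fun _ _ h => h⟩ (by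
      rintro t ⟨htu, htI, htL⟩ a -
      set t1 := (t.setVtx v a).tick 1 with ht1
      have h1u : t1.vtx u = i := by simpa [ht1, Store.tick, Store.setVtx] using htu
      have h1v : t1.vtx v = a := by simp [ht1, Store.tick, Store.setVtx]
      by_cases hcond : G.Adj i a ∧ i < a
      · have htest : (Test.and (.adj u v) (.lt u v)).eval G t1 = true := by
          simpa [Test.eval, h1u, h1v] using hcond
        simp only [Cmd.run]
        rw [if_pos htest]
        set t2 := t1.tick ((Test.and (.adj u v) (.lt u v)).cost n + 1) with ht2
        have h2u : t2.vtx u = i := h1u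
        have h2v : t2.vtx v = a := h1v
        have hadj : G.Adj (t2.vtx u) (t2.vtx v) := by rw [h2u, h2v]; exact hcond.1
        have hspec := (treatEdge_spec hG hadj).2
        rw [h2u, h2v] at hspec
        have hlater : Later G t (treatEdge.run G t2) := fun H hH hav h =>
          hav ((hspec H hH).mp h).1
        refine ⟨⟨(Cmd.run_vtx G (by decide) t2).trans h2u, Invariant.treatEdge hG hadj htI,
          fun H hH hav => hlater H hH (htL H hH hav)⟩, fun _ _ H hH hsep hav => ?_, ?_⟩
        · exact ((hspec H hH).mp hav).2 hsep
        · exact fun j hj hij hij' => (hj hij hij').mono hlater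
      · have htest : ¬ (Test.and (.adj u v) (.lt u v)).eval G t1 = true := by
          simpa [Test.eval, h1u, h1v] using hcond
        simp only [Cmd.run]
        rw [if_neg htest]
        exact ⟨⟨h1u, htI, htL⟩, fun h h' => absurd ⟨h, h'⟩ hcond, fun _ hj => hj⟩)
  exact ⟨h.1.2, fun j => h.2.1 j (List.mem_finRange j)⟩

theorem outer_loop (hG : G.Connected) {s : Store n} (hs : Invariant G s) :
    let s' := (Cmd.forVertex u (.forVertex v
      (.ite (.and (.adj u v) (.lt u v)) treatEdge .skip))).run G s
    Invariant G s' ∧ ∀ i j, G.Adj i j → i < j → Treated G i j s' := by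
  intro s'
  have h := List.foldl_induction_done (l := List.finRange n) (b := s.tick 1)
    (f := fun s a => (Cmd.forVertex v
      (.ite (.and (.adj u v) (.lt u v)) treatEdge .skip)).run G ((s.setVtx u a).tick 1))
    (p := Invariant G) (done := fun i t => ∀ j, G.Adj i j → i < j → Treated G i j t)
    hs (by
      intro t ht a _
      obtain ⟨⟨h1, h2⟩, h3⟩ := inner_loop (i := a) (s := (t.setVtx u a).tick 1) hG
        (by simp [Store.tick, Store.setVtx]) ht
      exact ⟨h1, h3, fun c hc j hj hj' => (hc j hj hj').mono h2⟩)
  exact ⟨h.1, fun i => h.2.1 i (List.mem_finRange i)⟩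

theorem mhFptList_out (hG : G.Connected) {s : Store n} (hs : s.out = []) :
    (mhFptList.run G s).out.Nodup ∧
      ∀ H : Finset (Fin n), H ∈ (mhFptList.run G s).out ↔
        IsMHalfspace G (H : Set (Fin n)) := by
  set s1 := (Cmd.seq (.pairsOf B x y (.not (.eq x x))) <| .seq (.setOf X x (.not (.eq x x))) <|
    .seq (.print X) <| .seq (.setOf X x (.eq x x)) (.print X)).run G s with hs1
  have h1B : s1.pairs B = ∅ := by
    ext q
    simp [hs1, Cmd.run, Test.eval, Store.tick, Store.setSet, Store.setPairs]
  have h1out : s1.out = [∅, Finset.univ] := by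
    simp [hs1, Cmd.run, Test.eval, Store.tick, Store.setSet, Store.setPairs, hs]
  have hinv : Invariant G s1 := by
    have : Nonempty (Fin n) := hG.nonempty
    refine ⟨?_, fun H => ?_⟩
    · rw [h1out]
      simpa using Finset.univ_nonempty.ne_empty.symm
    · have hav : Avoids G (s1.pairs B) H := by simp [Avoids, h1B]
      rw [h1out]
      simp only [List.mem_cons, List.not_mem_nil, or_false, hav, not_true_eq_false,
        iff_and_self]
      rintro (rfl | rfl) <;> simp [IsMHalfspace, IsMConvex]
  obtain ⟨h1, h2⟩ := outer_loop hG hinv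
  exact ⟨h1.1, h1.mem_out_iff hG h2⟩

/-! ## The number of steps -/

theorem treatEdge_isBounded : treatEdge.IsBounded G (2 ^ G.cliqueNum) := by
  intro s
  have hM : 1 ≤ 2 ^ G.cliqueNum := Nat.one_le_two_pow
  set s1 := computeTriangle.run G s with hs1
  set s2 := computeParity.run G s1 with hs2
  set s3 := s2.tick (isBipartiteTest.cost n + 1) with hs3
  set s4 := chooseRepresentatives.run G s3 with hs4
  have hP : IsParity (coGraph G (s2.set D)) (s2.set D) (s2.pairs Ev) (s2.pairs Od) := by
    rw [show s2.set D = s1.set D from Cmd.run_set G (by decide) s1]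
    exact isParity_computeParity (s.vtx u).pos s1
  have h4R : s4.set R = representatives (s2.set D) (s2.pairs Ev) (s2.pairs Od) :=
    chooseRepresentatives_set s3
  have hcard : 2 ^ (s4.set R).card ≤ 2 ^ G.cliqueNum := by
    rw [h4R]
    exact Nat.pow_le_pow_right two_pos (hP.isClique_representatives).card_le_cliqueNum
  have b1 := Cmd.isBounded_of_subsetFree (G := G) hM (c := computeTriangle) (by decide) s
  have b2 := Cmd.isBounded_of_subsetFree (G := G) hM (c := computeParity) (by decide) s1
  have b4 := Cmd.isBounded_of_subsetFree (G := G) hM (c := chooseRepresentatives) (by decide) s3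
  have b5 := Cmd.run_forSubset_steps_le (A := U)
    (Cmd.isBounded_of_subsetFree (G := G) le_rfl (c := trySubset) (by decide)) hcard
  have b6 := Cmd.isBounded_of_subsetFree (G := G) hM (c := markEdge) (by decide)
    ((Cmd.forSubset U R trySubset).run G s4)
  rw [← hs1] at b1
  rw [← hs2] at b2
  rw [← hs4] at b4
  have bt := Nat.mul_le_mul_right (isBipartiteTest.cost n + 1) hM
  have hpoly : treatEdge.stepPoly = computeTriangle.stepPoly + (computeParity.stepPoly +
      (isBipartiteTest.costPoly + 1 + (chooseRepresentatives.stepPoly +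
        ((Cmd.forSubset U R trySubset).stepPoly + (markEdge.stepPoly + 1))) + 1 + 1)) := rfl
  have hrun : treatEdge.run G s = (if isBipartiteTest.eval G s2 = true then
      (markEdge.run G ((Cmd.forSubset U R trySubset).run G s4)).tick 1 else s3.tick 1).tick 1 :=
    rfl
  have h3 : s3.steps = s2.steps + (isBipartiteTest.cost n + 1) := rfl
  rw [hrun, hpoly]
  simp only [Polynomial.eval_add, Polynomial.eval_one, Test.costPoly_eval]
  simp only [Nat.mul_add, Nat.one_mul, Nat.mul_one] at bt ⊢
  split_ifs
  · simp only [Store.tick]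
    omega
  · simp only [Store.tick]
    omega

theorem mhFptList_isBounded : mhFptList.IsBounded G (2 ^ G.cliqueNum) := by
  have hM : 1 ≤ 2 ^ G.cliqueNum := Nat.one_le_two_pow
  have h : ∀ {c : Cmd}, c.subsetFree = true → c.IsBounded G (2 ^ G.cliqueNum) :=
    fun hc => Cmd.isBounded_of_subsetFree hM hc
  have hskip : Cmd.skip.IsBounded G (2 ^ G.cliqueNum) := h rfl
  exact .seq (h rfl) <| .seq (h rfl) <| .seq (h rfl) <| .seq (h rfl) <| .seq (h rfl) <|
    .seq (.forVertex hM <| .forVertex hM <| treatEdge_isBounded.ite hM hskip) hskip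

end MhFptList

theorem mainTheorem11 :
    ∃ P : Polynomial ℕ,
      ∀ (n : ℕ) (G : SimpleGraph (Fin n)) [DecidableRel G.Adj], G.Connected →
        (∀ s : GraphProgram.Store n, s.out = [] → s.steps = 0 →
          (mhFptList.run G s).out.Nodup ∧
          (∀ H : Finset (Fin n), H ∈ (mhFptList.run G s).out ↔ IsMHalfspace G (H : Set (Fin n))) ∧
          (mhFptList.run G s).steps ≤ 2 ^ G.cliqueNum * P.eval n) ∧
        (∀ H : Set (Fin n), IsMHalfspace G H → ∀ u v : Fin n, G.Adj u v → u ∈ H → v ∉ H →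
          ((G.induce (triangleSet G u v))ᶜ).IsBipartite ∧
          (∀ x ∈ triangleSet G u v, ∀ y ∈ triangleSet G u v, x ≠ y → ¬ G.Adj x y →
            (x ∈ H ↔ y ∉ H)) ∧
          H = ⋃ z ∈ triangleSet G u v ∩ H, mShadow G z v) := by
  refine ⟨mhFptList.stepPoly, fun n G _ hG => ⟨fun s hout hsteps => ?_, ?_⟩⟩
  · obtain ⟨h1, h2⟩ := MhFptList.mhFptList_out hG hout
    refine ⟨h1, h2, ?_⟩
    have h3 := MhFptList.mhFptList_isBounded (G := G) s
    rwa [hsteps, Nat.zero_add] at h3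
  · intro H hH u v huv hu hv
    exact ⟨hH.isBipartite huv hu hv,
      fun x hx y hy hxy hadj => hH.mem_iff_notMem huv hu hv hx hy hxy hadj,
      hH.eq_iUnion_mShadow hG huv hu hv⟩
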